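/- **Definitions.** For a sequence $x=(x_1,\dots,x_n)$ of nonnegative integers let $\mathrm{asc}(x)=|\{1\le j<n: x_j<x_{j+1}\}|$. It is an *ascent sequence* if $n\ge 1$, $x_1=0$ and $x_i\le 1+\mathrm{asc}(x_1,\dots,x_{i-1})$ for $2\le i\le n$. Its *modified ascent sequence* $\widehat x$ is obtained as follows: for each $i$ with $x_i<x_{i+1}$ (positions read off the original $x$), taken in increasing order, increase by one every current entry at a position $j<i$ that is at least the current entry at position $i+1$. *Permutations.* $\mathcal R_n$ is the set of permutations $\pi=\pi_1\cdots\pi_n$ of $\{1,\dots,n\}$ with no $i<k$ such that $\pi_k+1=\pi_i<\pi_{i+1}$. A site of $\tau\in\mathcal R_{m}$ (before, between or after its entries) is *active* if inserting $m+1$ there gives an element of $\mathcal R_{m+1}$; active sites are labelled $0,1,2,\dots$ from left to right. Put $\Lambda(1)=(0)$; if $n\ge2$ and $\pi\in\mathcal R_n$ is obtained by inserting $n$ in the active site labelled $i$ of $\tau\in\mathcal R_{n-1}$, then $\Lambda(\pi)$ is $\Lambda(\tau)$ followed by $i$. Let $s(\pi)$ be the number of active sites of $\pi$ and $b(\pi)$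 the label of the site immediately to the left of its maximal entry. *Posets.* All posets are finite and nonempty. A poset is $(\mathbf{2+2})$-free if no induced subposet is a disjoint union of two 2-element chains; then its distinct strict principal down-sets $D(v)=\{y:y<v\}$ form a chain $\emptyset=D_0\subset D_1\subset\dots\subset D_k$. Put $\mathrm{rank}(P)=k$, and $\mathrm{rank}(v)=i$ (the *level* of $v$) if $D(v)=D_i$; $\mathrm{srank}(P)$ is the minimum level containing a maximal element. The one-element poset has $\Psi(P)=(0)$. If $|P|\ge2$, let $i=\mathrm{srank}(P)$ and let $v$ be a maximal element at level $i$. If $v$ is the only element at level $i$ and $i<\mathrm{rank}(P)$, first delete all relations $x<y$ with $x\in D_{i+1}\setminus D_i$. In all cases then remove $v$; with $Q$ the resulting poset, $\Psi(P)$ is $\Psi(Q)$ followed by $i$ (up to isomorphism, $Q$ does not depend on the choice of $v$). *Statistics.* $\min(P)$ and $\max(P)$ are the numbers of minimal and maximal elements of $P$. For a sequence or permutation, $\mathrm{zeros}$ is the number of zeros, $\mathrm{last}$ the last entry, $\mathrm{lmin}$ the number of letters with no smaller letter to their left, $\mathrm{rmax}$ the number of letters with no larger letter to their right (the *right-to-left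 maxima*). For sequences, $y\oplus z$ is $y$ followed by $z$ with $1+\max(y)$ added to each letter; for permutations, $\sigma\oplus\tau$ is $\sigma$ followed by $\tau$ with $|\sigma|$ added to each letter; for posets, $\oplus$ is the ordinal sum. In each case $\mathrm{comp}$ is the largest $k$ such that the object is the sum of $k$ nonempty sequences of nonnegative integers, permutations, or posets, respectively. Finally $$\lambda(P,q)=\sum_{v\in P}q^{\mathrm{rank}(v)},\qquad \chi(x,q)=\sum_{i=1}^{n}q^{x_i},\qquad \delta(\pi,q)=\sum_{i=0}^{s(\pi)}d_iq^i,$$ where $d_i$ is the number of entries of $\pi$ between the active sites labelled $i$ and $i+1$; and $\overline\lambda,\overline\chi,\overline\delta$ are defined in the same way, counting only the maximal elements of $P$, the right-to-left maxima of $x$, and the right-to-left maxima of $\pi$, respectively. **Theorem 5.1.** Let $x$ be an ascent sequence of length $n\ge1$, with modified ascent sequence $\widehat x$. There are exactly one $\pi\in\mathcal R_n$ with $\Lambda(\pi)=x$ and, up to isomorphism, exactly one $(\mathbf{2+2})$-free poset $P$ with $\Psi(P)=x$, and for these $$\begin{aligned} \min(P)&=\mathrm{zeros}(x)=\mathrm{lmin}(\pi);\\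 \mathrm{srank}(P)&=\mathrm{last}(x)=b(\pi);\\ \mathrm{rank}(P)&=\mathrm{asc}(x)=\mathrm{asc}(\pi^{-1});\\ \max(P)&=\mathrm{rmax}(\widehat x)=\mathrm{rmax}(\pi);\\ \mathrm{comp}(P)&=\mathrm{comp}(\widehat x)=\mathrm{comp}(\pi);\\ \lambda(P,q)&=\chi(\widehat x,q)=\delta(\pi,q);\\ \overline\lambda(P,q)&=\overline\chi(\widehat x,q)=\overline\delta(\pi,q). \end{aligned}$$ -/

import Mathlib

namespace Fishburn

open Polynomial

universe u

/-! ### Words and sequences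

Finite sequences of nonnegative integers, and permutations in one-line notation, are
lists of natural numbers. Positions in lists are counted from `0`, so the entry
`x_{i+1}` of a sequence `x_1, …, x_n` is `x.getD i 0` (only positions inside the list are
ever read). -/

/-- The increasing list of the (zero-based) positions `i` with `x_i < x_{i+1}`. -/
def ascList (x : List ℕ) : List ℕ :=
  (List.range (x.length - 1)).filter fun i => x.getD i 0 < x.getD (i + 1) 0

/-- The number of ascents. -/
def asc (x : List ℕ) : ℕ := (ascList x).length

/-- Ascent sequences (of length at least one): the first entry is `0` and every later entry is
at most one more than the number of ascents of the part of the sequence before it. -/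
def IsAscentSeq (x : List ℕ) : Prop :=
  x.head? = some 0 ∧ ∀ i < x.length, 0 < i → x.getD i 0 ≤ 1 + asc (x.take i)

/-- One pass of the modification algorithm, for the ascent position `i`: every entry strictly to
the left of position `i` that is at least the entry at position `i + 1` is increased by one. -/
def modifyStep (y : List ℕ) (i : ℕ) : List ℕ :=
  y.mapIdx fun j a => if j < i ∧ y.getD (i + 1) 0 ≤ a then a + 1 else a

/-- The modified sequence: run the passes for the ascent positions of `x`, from left
to right. -/
def modified (x : List ℕ) : List ℕ := (ascList x).foldl modifyStep x

/-- The number of zeros. -/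
def zeros (x : List ℕ) : ℕ := x.count 0

/-- The last entry (of a nonempty sequence). -/
def last (x : List ℕ) : ℕ := x.getLastD 0

/-- The (weak) right-to-left maxima, as positions: no larger letter is to the right. -/
def rmaxPos (x : List ℕ) : Finset ℕ :=
  (Finset.range x.length).filter fun i => ∀ j < x.length, i < j → x.getD j 0 ≤ x.getD i 0

/-- The number of right-to-left maxima. -/
def rmax (x : List ℕ) : ℕ := (rmaxPos x).card

/-- The number of left-to-right minima: letters with no smaller letter to the left. -/
def lmin (x : List ℕ) : ℕ :=
  ((Finset.range x.length).filter fun i => ∀ j < i, x.getD i 0 ≤ x.getD j 0).card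

/-- The maximal letter of a (nonempty) sequence. -/
def maxLetter (x : List ℕ) : ℕ := x.foldr max 0

/-- The sum `y ⊕ z` of two sequences: `1 + max y` is added to the letters of `z`. -/
def seqSum (y z : List ℕ) : List ℕ := y ++ z.map (· + (1 + maxLetter y))

/-- `x` is the sum of `k` nonempty sequences. -/
def IsSeqSum (k : ℕ) (x : List ℕ) : Prop :=
  ∃ ys : List (List ℕ), ys.length = k ∧ (∀ y ∈ ys, y ≠ []) ∧ ys.foldr seqSum [] = x

/-- The number of components of a sequence: the largest `k` such that it is the sum of `k`
nonempty sequences. -/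
noncomputable def seqComp (x : List ℕ) : ℕ := sSup {k | IsSeqSum k x}

/-- The polynomial `∑ q ^ x_i`. -/
noncomputable def chi (x : List ℕ) : ℕ[X] :=
  ∑ i ∈ Finset.range x.length, X ^ x.getD i 0

/-- The polynomial `∑ q ^ x_i`, over the right-to-left maxima `x_i` only. -/
noncomputable def chiBar (x : List ℕ) : ℕ[X] := ∑ i ∈ rmaxPos x, X ^ x.getD i 0

/-! ### Permutations -/

/-- One-line notation of a permutation of `n` letters, as a word on `1, …, n`. -/
def word {n : ℕ} (π : Equiv.Perm (Fin n)) : List ℕ := List.ofFn fun i => (π i : ℕ) + 1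

/-- The sum of two permutation words: the length of the first is added to the letters of
the second. -/
def permSum (σ τ : List ℕ) : List ℕ := σ ++ τ.map (· + σ.length)

/-- `w` is the sum of `k` nonempty permutations. -/
def IsPermSum (k : ℕ) (w : List ℕ) : Prop :=
  ∃ ws : List (List ℕ), ws.length = k ∧
    (∀ v ∈ ws, v ≠ [] ∧ v.Perm (List.range' 1 v.length)) ∧ ws.foldr permSum [] = w

/-- The number of components of a permutation: the largest `k` such that it is the sum of `k`
nonempty permutations. -/
noncomputable def permComp (w : List ℕ) : ℕ := sSup {k | IsPermSum k w}

/-- Whenever `w_i w_j w_k` (with `i < j < k`) has the relative order of `231`, either `i` and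
`j` are not adjacent positions or `w_i` and `w_k` are not adjacent values. -/
def Avoids (w : List ℕ) : Prop :=
  ∀ k < w.length, ∀ j < k, ∀ i < j,
    (w.getD k 0 < w.getD i 0 ∧ w.getD i 0 < w.getD j 0) →
      (j ≠ i + 1 ∨ w.getD i 0 ≠ w.getD k 0 + 1)

instance (w : List ℕ) : Decidable (Avoids w) := by
  unfold Avoids
  refine @Nat.decidableBallLT _ _ fun k _ => ?_
  refine @Nat.decidableBallLT _ _ fun j _ => ?_
  refine @Nat.decidableBallLT _ _ fun i _ => ?_
  infer_instance

/-- The class of pattern-avoiding permutations of `n` letters. -/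
def R (n : ℕ) : Set (Equiv.Perm (Fin n)) := {π | Avoids (word π)}

/-- A word of length `m` has the sites `0, …, m`; site `p` has exactly `p` letters to its left.
A site is active if inserting the new maximum `m + 1` there gives a pattern-avoiding
permutation. -/
def IsActive (w : List ℕ) (p : ℕ) : Prop :=
  p ≤ w.length ∧ Avoids (w.insertIdx p (w.length + 1))

instance (w : List ℕ) (p : ℕ) : Decidable (IsActive w p) := by
  unfold IsActive
  infer_instance

/-- The number of active sites. -/
def numActive (w : List ℕ) : ℕ :=
  ((Finset.range (w.length + 1)).filter fun p => IsActive w p).card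

/-- The label of the active site `p`: active sites are labelled `0, 1, 2, …` from left
to right. -/
def siteLabel (w : List ℕ) (p : ℕ) : ℕ :=
  ((Finset.range p).filter fun r => IsActive w r).card

/-- The label of the site immediately to the left of the maximal entry. -/
def b (w : List ℕ) : ℕ := siteLabel w (w.idxOf w.length)

/-- The recursive map from permutation words of length `n` to sequences of length `n`: if
`π` arises by inserting `n` in the active site labelled `i` of `τ`, append `i` to the sequence
of `τ`. -/
def LambdaAux : ℕ → List ℕ → List ℕ
  | 0, _ => []
  | 1, _ => [0]
  | n + 2, w =>
    let τ := w.erase (n + 2)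
    LambdaAux (n + 1) τ ++ [siteLabel τ (w.idxOf (n + 2))]

/-- The map `Λ` from permutations to sequences. -/
def Lambda {n : ℕ} (π : Equiv.Perm (Fin n)) : List ℕ := LambdaAux n (word π)

/-- The entry at position `p` is between the active sites labelled `i` and `i + 1`. -/
def EntryBetween (w : List ℕ) (i p : ℕ) : Prop :=
  ∃ s t, IsActive w s ∧ siteLabel w s = i ∧ IsActive w t ∧ siteLabel w t = i + 1 ∧
    s ≤ p ∧ p < t

open Classical in
/-- The polynomial `∑ d_i q ^ i`, where `d_i` counts the entries between the active sites
labelled `i` and `i + 1`. -/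
noncomputable def delta (w : List ℕ) : ℕ[X] :=
  ∑ i ∈ Finset.range (numActive w + 1),
    C ((Finset.range w.length).filter fun p => EntryBetween w i p).card * X ^ i

open Classical in
/-- The polynomial `∑ d_i q ^ i`, where `d_i` counts the right-to-left maxima between the active
sites labelled `i` and `i + 1`. -/
noncomputable def deltaBar (w : List ℕ) : ℕ[X] :=
  ∑ i ∈ Finset.range (numActive w + 1),
    C ((rmaxPos w).filter fun p => EntryBetween w i p).card * X ^ i

/-! ### Posets -/

section Poset

variable (P : Type u) [PartialOrder P]

/-- No induced subposet is isomorphic to the disjoint union of two chains with two elements.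
(The order on a sum type `⊕` is that of the disjoint union.) -/
def TwoTwoFree : Prop := IsEmpty ((Fin 2 ⊕ Fin 2) ↪o P)

/-- The level of `v`: the index of its set `Set.Iio v` of predecessors in the list
`D_0 ⊂ D_1 ⊂ … ⊂ D_k` of all predecessor sets, which is the number of predecessor
sets properly contained in it. -/
noncomputable def level {P : Type u} [PartialOrder P] (v : P) : ℕ :=
  {S | S ∈ Set.range (Set.Iio : P → Set P) ∧ S ⊂ Set.Iio v}.ncard

/-- The rank `k` of the poset, where `D_0 ⊂ D_1 ⊂ … ⊂ D_k` are the predecessor sets. -/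
noncomputable def rank : ℕ := (Set.range (Set.Iio : P → Set P)).ncard - 1

/-- The minimum level containing a maximal element. -/
noncomputable def srank : ℕ := sInf {i | ∃ v : P, IsMax v ∧ level v = i}

/-- The set `L_i` of the elements at level `i`. -/
def levelSet (i : ℕ) : Set P := {v | level v = i}

/-- The predecessor set `D_i`, shared by all the elements at level `i`. -/
def predSet (i : ℕ) : Set P := {y | ∃ v ∈ levelSet P i, y < v}

open Classical in
/-- The set of elements that the removal operation turns into maximal elements: it is
`D_{i+1} \ D_i` if the level `i = srank P` has only one element and `i < rank P`
and empty otherwise. -/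
noncomputable def newMax : Set P :=
  if (levelSet P (srank P)).ncard = 1 ∧ srank P < rank P then
    predSet P (srank P + 1) \ predSet P (srank P)
  else ∅

/-- The order obtained by deleting all relations `x < y` with `x ∈ N`. -/
@[reducible]
def deleteAbove (N : Set P) : PartialOrder P where
  le x y := x = y ∨ (x < y ∧ x ∉ N)
  lt x y := x < y ∧ x ∉ N
  lt_iff_le_not_ge x y := by
    constructor
    · rintro ⟨h1, h2⟩
      refine ⟨Or.inr ⟨h1, h2⟩, ?_⟩
      rintro (h | ⟨h, _⟩)
      · exact absurd (h ▸ h1) (lt_irrefl _)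
      · exact lt_asymm h h1
    · rintro ⟨h | h, h'⟩
      · exact absurd (Or.inl h.symm) h'
      · exact h
  le_refl _ := Or.inl rfl
  le_trans x y z hxy hyz := by
    rcases hxy with rfl | ⟨h1, h2⟩
    · exact hyz
    · rcases hyz with rfl | ⟨h3, _⟩
      · exact Or.inr ⟨h1, h2⟩
      · exact Or.inr ⟨h1.trans h3, h2⟩
  le_antisymm x y hxy hyx := by
    rcases hxy with h | ⟨h1, _⟩
    · exact h
    · rcases hyx with h | ⟨h3, _⟩
      · exact h.symm
      · exact absurd (h1.trans h3) (lt_irrefl _)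

/-- The poset left after the removal operation has removed `v`. -/
@[reducible]
noncomputable def removeOrder {P : Type u} [PartialOrder P] (v : P) :
    PartialOrder {y : P // y ≠ v} :=
  @PartialOrder.lift _ _ (deleteAbove P (newMax P)) Subtype.val Subtype.val_injective

open Classical in
/-- The recursive map from posets with `n` elements to sequences of length `n`: remove a maximal
element of minimal level `i` and append `i` to the sequence of the remaining poset. -/
noncomputable def PsiAux : ℕ → (P : Type u) → PartialOrder P → List ℕ
  | 0, _, _ => []
  | 1, _, _ => [0]
  | n + 2, P, _ =>
    if h : ∃ v : P, IsMax v ∧ level v = srank P then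
      PsiAux (n + 1) {y : P // y ≠ h.choose} (removeOrder h.choose) ++ [srank P]
    else []

/-- The map `Ψ` from finite posets to sequences. -/
noncomputable def Psi : List ℕ := PsiAux (Nat.card P) P inferInstance

/-- The number of minimal elements. -/
noncomputable def numMin : ℕ := {v : P | IsMin v}.ncard

/-- The number of maximal elements. -/
noncomputable def numMax : ℕ := {v : P | IsMax v}.ncard

/-- `P` is (isomorphic to) the ordinal sum of `k` nonempty posets. -/
def IsOrdinalSum (k : ℕ) : Prop :=
  ∃ (Q : Fin k → Type u) (_ : ∀ i, PartialOrder (Q i)),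
    (∀ i, Nonempty (Q i)) ∧ Nonempty (P ≃o Lex (Sigma Q))

/-- The number of components of a poset: the largest `k` such that it is the ordinal sum of `k`
nonempty posets. -/
noncomputable def posetComp : ℕ := sSup {k | IsOrdinalSum P k}

/-- The level polynomial `∑ q ^ (level v)`. -/
noncomputable def lam [Fintype P] : ℕ[X] := ∑ v : P, X ^ level v

open Classical in
/-- The level polynomial `∑ q ^ (level v)`, over the maximal elements `v` only. -/
noncomputable def lamBar [Fintype P] : ℕ[X] :=
  ∑ v ∈ Finset.univ.filter (fun v : P => IsMax v), X ^ level v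

end Poset

end Fishburn

namespace Fishburn

open Polynomial

universe u

/-! ### Modified ascent sequences as functions -/

/-! Everything is decoded from the modified sequence `y = modified x`, whose largest letter is k =
asc x. Appending a letter i to an ascent sequence changes `y` in one of two ways (`Extends`). If i
is larger than the last letter, the letters that are at least i go up by one and i takes the vacated
value; otherwise i is simply appended. By induction the letters of `y` form an initial segment, and
its ascent tops are exactly the first occurrences of nonzero letters (`IsModifiedAscent`).

Permutations: π lists 1, …, n by increasing key `y (a - 1)`, with ties in decreasing order of a
(`SortedBy`). It is thus a concatenation of decreasing blocks, one for each value c. The letter a -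
1 stands after a exactly when a - 1 is not the index of a first occurrence in `y`, so the active
sites are the block boundaries, and the site in front of block c has label c
(`SortedBy.isActive_iff`, `SortedBy.siteLabel_cutPos`). Inserting n + 1 at the site labelled i
therefore realises the extension by i (`IsAscentSeq.lambdaAux_iff`).

Posets: a (2+2)-free poset is an interval order, with intervals in {0, …, k} such that each of 0, …,
k is both a left and a right endpoint (`exists_intervalRep`). The left endpoint of an element is its
level, and the maximal elements are those with right endpoint k. The removal operation acts on the
endpoints in one of three explicit ways (`IntervalRep.removal`), and comparison with `Extends` shows
that Ψ(P) = x holds exactly when the intervals of P are, up to relabelling, the `[y j, reach n y j]`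
(`IsAscentSeq.psiAux_iff`). Existence, uniqueness and the statistics are read off from this: levels
are letters of `y`, and maximal elements are right-to-left maxima (`reach_eq_peak_iff`).

Components are compared through one notion, `Layered`: a cut into consecutive blocks with increasing
letters. For the poset this rests on `layered_iff`, which says that such cuts of `y` are the ordinal
sum decompositions of the interval order. -/

/-- The largest of the first `n` letters. -/
def peak (n : ℕ) (y : ℕ → ℕ) : ℕ := (Finset.range n).sup y

theorem le_peak {n j : ℕ} (y : ℕ → ℕ) (h : j < n) : y j ≤ peak n y :=
  Finset.le_sup (f := y) (Finset.mem_range.2 h)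

theorem peak_le {n c : ℕ} {y : ℕ → ℕ} (h : ∀ j < n, y j ≤ c) : peak n y ≤ c :=
  Finset.sup_le fun j hj => h j (Finset.mem_range.1 hj)

theorem exists_eq_peak {n : ℕ} (y : ℕ → ℕ) (h : 0 < n) : ∃ j < n, y j = peak n y := by
  obtain ⟨j, hj, e⟩ := Finset.exists_mem_eq_sup (Finset.range n) ⟨0, Finset.mem_range.2 h⟩ y
  exact ⟨j, Finset.mem_range.1 hj, e.symm⟩

theorem peak_eq {n c : ℕ} {y : ℕ → ℕ} (h : ∀ j < n, y j ≤ c) (h' : ∃ j < n, y j = c) :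
    peak n y = c := by
  obtain ⟨j, hj, rfl⟩ := h'
  exact le_antisymm (peak_le h) (le_peak y hj)

/-- Make room for a new letter `i`. -/
def bump (i a : ℕ) : ℕ := if i ≤ a then a + 1 else a

/-- The sequence `y 0, …, y (n - 1)` starts with `0`, its letters form an initial segment of `ℕ`,
and its ascent tops are the first occurrences of the nonzero letters. -/
structure IsModifiedAscent (n : ℕ) (y : ℕ → ℕ) : Prop where
  pos : 0 < n
  zero : y 0 = 0
  surj : ∀ j < n, ∀ c ≤ y j, ∃ l < n, y l = c
  first : ∀ j, j + 1 < n → (y j < y (j + 1) ↔ ∀ l ≤ j, y l ≠ y (j + 1))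

theorem IsModifiedAscent.exists_eq {n : ℕ} {y : ℕ → ℕ} (h : IsModifiedAscent n y) {c : ℕ}
    (hc : c ≤ peak n y) : ∃ l < n, y l = c := by
  obtain ⟨j, hj, e⟩ := exists_eq_peak y h.pos
  exact h.surj j hj c (e ▸ hc)

/-- `y'` arises from the modified ascent sequence `y` of length `n` by appending the letter `i`,
after making room for it if this creates an ascent. -/
def Extends (n : ℕ) (y y' : ℕ → ℕ) (i : ℕ) : Prop :=
  y' n = i ∧
    ((y (n - 1) < i ∧ i ≤ peak n y + 1 ∧ ∀ j < n, y' j = bump i (y j)) ∨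
      (i ≤ y (n - 1) ∧ ∀ j < n, y' j = y j))

theorem bump_lt_bump {i a c : ℕ} : bump i a < bump i c ↔ a < c := by
  unfold bump; split_ifs <;> omega

theorem bump_le_bump {i a c : ℕ} : bump i a ≤ bump i c ↔ a ≤ c := by
  unfold bump; split_ifs <;> omega

theorem bump_inj {i a c : ℕ} : bump i a = bump i c ↔ a = c := by
  unfold bump; split_ifs <;> omega

theorem bump_ne (i a : ℕ) : bump i a ≠ i := by
  unfold bump; split_ifs <;> omega

theorem bump_lt_iff {i a : ℕ} : bump i a < i ↔ a < i := by
  unfold bump; split_ifs <;> omega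

theorem bump_of_lt {i a : ℕ} (h : a < i) : bump i a = a := by
  unfold bump; split_ifs <;> omega

theorem bump_of_le {i a : ℕ} (h : i ≤ a) : bump i a = a + 1 := by
  unfold bump; split_ifs; rfl

theorem Extends.lt_iff {n : ℕ} {y y' : ℕ → ℕ} {i : ℕ} (h : Extends n y y' i) {j l : ℕ}
    (hj : j < n) (hl : l < n) : y' j < y' l ↔ y j < y l := by
  rcases h.2 with ⟨-, -, h⟩ | ⟨-, h⟩ <;> simp [h j hj, h l hl, bump_lt_bump]

theorem Extends.eq_iff {n : ℕ} {y y' : ℕ → ℕ} {i : ℕ} (h : Extends n y y' i) {j l : ℕ}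
    (hj : j < n) (hl : l < n) : y' j = y' l ↔ y j = y l := by
  rcases h.2 with ⟨-, -, h⟩ | ⟨-, h⟩ <;> simp [h j hj, h l hl, bump_inj]

theorem Extends.lt_letter_iff {n : ℕ} {y y' : ℕ → ℕ} {i : ℕ} (h : Extends n y y' i) {j : ℕ}
    (hj : j < n) : y' j < i ↔ y j < i := by
  rcases h.2 with ⟨-, -, h⟩ | ⟨-, h⟩ <;> simp [h j hj, bump_lt_iff]

theorem Extends.letter_le {n : ℕ} {y y' : ℕ → ℕ} {i : ℕ} (h : Extends n y y' i) (hn : 0 < n) :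
    i ≤ peak n y + 1 := by
  rcases h.2 with ⟨-, h, -⟩ | ⟨h, -⟩
  · exact h
  · have := le_peak y (show n - 1 < n by omega)
    omega

theorem Extends.peak_of_lt {n : ℕ} {y y' : ℕ → ℕ} {i : ℕ} (h : Extends n y y' i) (hn : 0 < n)
    (hi : y (n - 1) < i) : peak (n + 1) y' = peak n y + 1 := by
  obtain ⟨h0, ⟨-, h1, h2⟩ | ⟨h1, -⟩⟩ := h
  · apply peak_eq
    · intro j hj
      rcases Nat.lt_succ_iff_lt_or_eq.1 hj with hj | rfl
      · have := le_peak y hj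
        rw [h2 j hj]
        unfold bump
        split_ifs <;> omega
      · omega
    · by_cases hi' : i = peak n y + 1
      · exact ⟨n, by omega, by omega⟩
      · obtain ⟨j, hj, e⟩ := exists_eq_peak y hn
        exact ⟨j, by omega, by rw [h2 j hj, e, bump_of_le (by omega)]⟩
  · omega

theorem Extends.peak_of_le {n : ℕ} {y y' : ℕ → ℕ} {i : ℕ} (h : Extends n y y' i) (hn : 0 < n)
    (hi : i ≤ y (n - 1)) : peak (n + 1) y' = peak n y := by
  obtain ⟨h0, ⟨h1, -, -⟩ | ⟨h1, h2⟩⟩ := h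
  · omega
  · apply peak_eq
    · intro j hj
      rcases Nat.lt_succ_iff_lt_or_eq.1 hj with hj | rfl
      · rw [h2 j hj]; exact le_peak y hj
      · have := le_peak y (show j - 1 < j by omega)
        omega
    · obtain ⟨j, hj, e⟩ := exists_eq_peak y hn
      exact ⟨j, by omega, by rw [h2 j hj, e]⟩

/-- In the ascent case bumping vacates exactly the value i, so the new letter is both an ascent top
and a first occurrence. In the other case i ≤ `y (n - 1)` has occurred already, because the letters
form an initial segment. -/
theorem IsModifiedAscent.extend {n : ℕ} {y y' : ℕ → ℕ} {i : ℕ} (h : IsModifiedAscent n y)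
    (e : Extends n y y' i) : IsModifiedAscent (n + 1) y' where
  pos := by omega
  zero := by
    have := h.zero
    rcases e.2 with ⟨h1, h2, h3⟩ | ⟨h2, h3⟩
    · rw [h3 0 h.pos, bump_of_lt] <;> omega
    · rw [h3 0 h.pos, this]
  surj := by
    suffices ∀ c ≤ peak (n + 1) y', ∃ l < n + 1, y' l = c from
      fun j hj c hc => this c (hc.trans (le_peak y' hj))
    intro c hc
    rcases e.2 with ⟨h1, h2, h3⟩ | ⟨h1, h3⟩
    · rw [e.peak_of_lt h.pos h1] at hc
      rcases lt_trichotomy c i with hci | rfl | hci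
      · obtain ⟨l, hl, rfl⟩ := h.exists_eq (show c ≤ peak n y by omega)
        exact ⟨l, by omega, by rw [h3 l hl, bump_of_lt hci]⟩
      · exact ⟨n, by omega, e.1⟩
      · obtain ⟨l, hl, hl'⟩ := h.exists_eq (show c - 1 ≤ peak n y by omega)
        exact ⟨l, by omega, by rw [h3 l hl, bump_of_le] <;> omega⟩
    · rw [e.peak_of_le h.pos h1] at hc
      obtain ⟨l, hl, rfl⟩ := h.exists_eq hc
      exact ⟨l, by omega, h3 l hl⟩
  first := by
    intro j hj
    rcases Nat.lt_succ_iff_lt_or_eq.1 hj with hj | rfl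
    · rw [e.lt_iff (by omega) hj, h.first j hj]
      refine forall₂_congr fun l hl => ?_
      rw [Ne, Ne, e.eq_iff (by omega) hj]
    · obtain ⟨e1, ⟨h1, h2, h3⟩ | ⟨h1, h3⟩⟩ := e
      · refine iff_of_true ?_ ?_
        · rw [e1, h3 j (by omega), bump_lt_iff]; exact h1
        · intro l hl
          rw [e1, h3 l (by omega)]
          exact bump_ne _ _
      · simp only [Nat.add_sub_cancel] at h1
        refine iff_of_false ?_ ?_
        · rw [e1, h3 j (by omega)]; omega
        · push Not
          obtain ⟨l, hl, hl'⟩ := h.surj j (by omega) i h1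
          exact ⟨l, by omega, by rw [h3 l hl, hl', e1]⟩

/-! ### Right endpoints -/

open Classical in
/-- The right endpoint of the interval with left endpoint `y j`: with `t` the first position after
`j` that carries a larger letter, the smaller one of `y t` and the largest letter before `t`;
if there is no such `t`, the largest letter. -/
noncomputable def reach (n : ℕ) (y : ℕ → ℕ) (j : ℕ) : ℕ :=
  if h : ∃ t, j < t ∧ t < n ∧ y j < y t then min (y (Nat.find h)) (peak (Nat.find h) y)
  else peak n y

/-- `t` is the first position after `j` that carries a larger letter. -/
structure IsNext (n : ℕ) (y : ℕ → ℕ) (j t : ℕ) : Prop where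
  lt : j < t
  lt_length : t < n
  larger : y j < y t
  between : ∀ s, j < s → s < t → y s ≤ y j

theorem IsNext.reach_eq {n : ℕ} {y : ℕ → ℕ} {j t : ℕ} (h : IsNext n y j t) :
    reach n y j = min (y t) (peak t y) := by
  classical
  have h' : ∃ t, j < t ∧ t < n ∧ y j < y t := ⟨t, h.lt, h.lt_length, h.larger⟩
  have : Nat.find h' = t := by
    rw [Nat.find_eq_iff]
    refine ⟨⟨h.lt, h.lt_length, h.larger⟩, fun s hs hs' => ?_⟩
    have := h.between s hs'.1 hs
    omega
  unfold reach
  rw [dif_pos h', this]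

theorem reach_of_rmax {n : ℕ} {y : ℕ → ℕ} {j : ℕ} (h : ∀ t < n, j < t → y t ≤ y j) :
    reach n y j = peak n y := by
  unfold reach
  rw [dif_neg]
  rintro ⟨t, h1, h2, h3⟩
  have := h t h2 h1
  omega

theorem rmax_or_isNext (n : ℕ) (y : ℕ → ℕ) (j : ℕ) :
    (∀ t < n, j < t → y t ≤ y j) ∨ ∃ t, IsNext n y j t := by
  classical
  by_cases h : ∃ t, j < t ∧ t < n ∧ y j < y t
  · obtain ⟨h1, h2, h3⟩ := Nat.find_spec h
    refine Or.inr ⟨Nat.find h, h1, h2, h3, fun s hs hs' => ?_⟩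
    have := Nat.find_min h hs'
    push Not at this
    exact this hs (by omega)
  · push Not at h
    exact Or.inl fun t h1 h2 => h t h2 h1

theorem le_reach {n : ℕ} (y : ℕ → ℕ) {j : ℕ} (hj : j < n) : y j ≤ reach n y j := by
  rcases rmax_or_isNext n y j with h | ⟨t, h⟩
  · rw [reach_of_rmax h]; exact le_peak y hj
  · rw [h.reach_eq]; exact le_min h.larger.le (le_peak y h.lt)

theorem reach_le_peak (n : ℕ) (y : ℕ → ℕ) (j : ℕ) : reach n y j ≤ peak n y := by
  rcases rmax_or_isNext n y j with h | ⟨t, h⟩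
  · rw [reach_of_rmax h]
  · rw [h.reach_eq]; exact (min_le_left _ _).trans (le_peak y h.lt_length)

/-- The letter just before t is at most `y j < y t`, so t is an ascent top and hence a first
occurrence. -/
theorem IsNext.ne_letter {n : ℕ} {y : ℕ → ℕ} {j t : ℕ} (h : IsNext n y j t)
    (hy : IsModifiedAscent n y) {l : ℕ} (hl : l < t) : y l ≠ y t := by
  obtain ⟨s, rfl⟩ : ∃ s, t = s + 1 := ⟨t - 1, by have := h.lt; omega⟩
  refine (hy.first s h.lt_length).1 ?_ l (by omega)
  rcases eq_or_lt_of_le (Nat.lt_succ_iff.1 h.lt) with rfl | hs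
  · exact h.larger
  · exact (h.between s hs (by omega)).trans_lt h.larger

/-- The letter at t differs from the maximum before t, so the smaller of the two is strictly below
the larger one, which is at most the overall peak. -/
theorem IsNext.reach_lt_peak {n : ℕ} {y : ℕ → ℕ} {j t : ℕ} (h : IsNext n y j t)
    (hy : IsModifiedAscent n y) : reach n y j < peak n y := by
  rw [h.reach_eq]
  obtain ⟨s, hs, e⟩ := exists_eq_peak y (show 0 < t by have := h.lt; omega)
  have h1 := h.ne_letter hy hs
  have h2 := le_peak y h.lt_length
  have h3 := le_peak y (hs.trans h.lt_length)
  omega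

/-- This is what turns maximal elements of the poset into right-to-left maxima of the modified
sequence. -/
theorem reach_eq_peak_iff {n : ℕ} {y : ℕ → ℕ} (hy : IsModifiedAscent n y) {j : ℕ} :
    reach n y j = peak n y ↔ ∀ t < n, j < t → y t ≤ y j := by
  refine ⟨fun h => ?_, reach_of_rmax⟩
  rcases rmax_or_isNext n y j with h' | ⟨t, h'⟩
  · exact h'
  · exact absurd h (h'.reach_lt_peak hy).ne

/-- Supplies the right endpoints in the interval representation. The top value is attained at the
last position; a smaller value c is attained just before a suitable ascent top t with min(`y t`,
`peak t y`) = c. -/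
theorem exists_reach_eq {n : ℕ} {y : ℕ → ℕ} (hy : IsModifiedAscent n y) {c : ℕ}
    (hc : c ≤ peak n y) : ∃ j < n, reach n y j = c := by
  classical
  rcases hc.eq_or_lt with rfl | hc'
  · exact ⟨n - 1, by have := hy.pos; omega, reach_of_rmax fun t h1 h2 => by omega⟩
  have key : ∀ t, 0 < t → t < n → y (t - 1) < y t → min (y t) (peak t y) = c →
      ∃ j < n, reach n y j = c := by
    intro t h0 h1 h2 h3
    have : IsNext n y (t - 1) t := ⟨by omega, h1, h2, fun s _ _ => by omega⟩
    exact ⟨t - 1, by omega, this.reach_eq.trans h3⟩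
  have hs := hy.exists_eq hc
  obtain ⟨hs1, hs2⟩ := Nat.find_spec hs
  have hs3 : ∀ l < Nat.find hs, y l ≠ c := fun l hl hl' =>
    Nat.find_min hs hl ⟨by omega, hl'⟩
  generalize Nat.find hs = s at hs1 hs2 hs3
  -- Here s is the first occurrence of c. If a letter of size at least c precedes it, then s is
  -- itself the required ascent top. Otherwise the first position t with a letter above c is: s
  -- comes before t, so the maximum before t is c.
  by_cases hm : 0 < s ∧ c ≤ peak s y
  · refine key s hm.1 hs1 ?_ (by omega)
    have := (hy.first (s - 1) (by omega)).2
    rw [show s - 1 + 1 = s by omega] at this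
    exact this fun l hl => by rw [hs2]; exact hs3 l (by omega)
  · have hsmall : ∀ l < s, y l < c := by
      intro l hl
      have := le_peak y hl
      by_contra h
      exact hm ⟨by omega, by omega⟩
    have ht : ∃ t, t < n ∧ c < y t := by
      obtain ⟨j, hj, e⟩ := exists_eq_peak y hy.pos
      exact ⟨j, hj, by omega⟩
    obtain ⟨ht1, ht2⟩ := Nat.find_spec ht
    have ht3 : ∀ l < Nat.find ht, y l ≤ c := fun l hl => by
      have := Nat.find_min ht hl
      by_contra h
      exact this ⟨by omega, by omega⟩
    generalize Nat.find ht = t at ht1 ht2 ht3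
    have hst : s < t := by
      by_contra h
      rcases eq_or_lt_of_le (not_lt.1 h) with rfl | h
      · omega
      · have := hsmall t h
        omega
    refine key t (by omega) ht1 ((ht3 (t - 1) (by omega)).trans_lt ht2) ?_
    rw [peak_eq ht3 ⟨s, hst, hs2⟩]
    omega

theorem peak_congr {n : ℕ} {y y' : ℕ → ℕ} (h : ∀ j < n, y' j = y j) : peak n y' = peak n y :=
  Finset.sup_congr rfl fun j hj => h j (Finset.mem_range.1 hj)

theorem peak_bump {n i : ℕ} {y y' : ℕ → ℕ} (hn : 0 < n) (h : ∀ j < n, y' j = bump i (y j)) :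
    peak n y' = bump i (peak n y) := by
  obtain ⟨j, hj, e⟩ := exists_eq_peak y hn
  refine peak_eq (fun l hl => ?_) ⟨j, hj, by rw [h j hj, e]⟩
  rw [h l hl, bump_le_bump]
  exact le_peak y hl

theorem Extends.isNext {n : ℕ} {y y' : ℕ → ℕ} {i j t : ℕ} (e : Extends n y y' i)
    (h : IsNext n y j t) : IsNext (n + 1) y' j t := by
  obtain ⟨h1, h2, h3, h4⟩ := h
  refine ⟨h1, by omega, (e.lt_iff (by omega) h2).2 h3, fun s hs hs' => ?_⟩
  have := h4 s hs hs'
  rw [← not_lt] at this ⊢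
  rwa [e.lt_iff (by omega) (by omega)]

theorem Extends.reach_last {n : ℕ} {y : ℕ → ℕ} :
    reach (n + 1) y n = peak (n + 1) y :=
  reach_of_rmax fun t h1 h2 => by omega

/-- The appended letter is never a first larger letter: a right-to-left maximum is at least `y (n -
1)`, hence at least i. -/
theorem Extends.reach_of_le {n : ℕ} {y y' : ℕ → ℕ} {i j : ℕ} (e : Extends n y y' i)
    (hi : i ≤ y (n - 1)) (hj : j < n) : reach (n + 1) y' j = reach n y j := by
  have h3 : ∀ j < n, y' j = y j := by
    rcases e.2 with ⟨h, -⟩ | ⟨-, h⟩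
    · omega
    · exact h
  rcases rmax_or_isNext n y j with h | ⟨t, h⟩
  · rw [reach_of_rmax h, reach_of_rmax, e.peak_of_le (by omega) hi]
    intro t ht hjt
    rcases Nat.lt_succ_iff_lt_or_eq.1 ht with ht | rfl
    · rw [h3 t ht, h3 j hj]; exact h t ht hjt
    · rw [e.1, h3 j hj]
      rcases eq_or_lt_of_le (show j ≤ t - 1 by omega) with rfl | hjt'
      · exact hi
      · exact hi.trans (h _ (by omega) hjt')
  · rw [h.reach_eq, (e.isNext h).reach_eq, h3 t h.lt_length,
      peak_congr fun s hs => h3 s (hs.trans h.lt_length)]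

/-- Endpoints below the peak are already determined and are only bumped. A right-to-left maximum
below i now has the new letter as its first larger letter, and one that is at least i keeps the top
as right endpoint. Since i ≤ peak + 1, the bumped old peak may be replaced by the old peak in the
minimum with i. -/
theorem Extends.reach_of_lt {n : ℕ} {y y' : ℕ → ℕ} {i j : ℕ} (e : Extends n y y' i)
    (hy : IsModifiedAscent n y) (hi : y (n - 1) < i) (hj : j < n) :
    reach (n + 1) y' j =
      if reach n y j < peak n y then bump i (reach n y j)
      else if y j < i then min i (peak n y) else peak n y + 1 := by
  obtain ⟨h2, h3⟩ : i ≤ peak n y + 1 ∧ ∀ j < n, y' j = bump i (y j) := by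
    rcases e.2 with ⟨-, h⟩ | ⟨h, -⟩
    · exact h
    · omega
  rcases rmax_or_isNext n y j with h | ⟨t, h⟩
  · rw [if_neg (by rw [reach_of_rmax h]; omega)]
    have hle : ∀ s, j < s → s < n → y' s ≤ y' j := fun s hs hs' => by
      rw [h3 s hs', h3 j hj, bump_le_bump]; exact h s hs' hs
    split_ifs with hji
    · have : IsNext (n + 1) y' j n :=
        ⟨hj, by omega, by rw [e.1]; exact (e.lt_letter_iff hj).2 hji, hle⟩
      rw [this.reach_eq, e.1, peak_bump hy.pos h3]
      unfold bump
      split_ifs <;> omega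
    · rw [reach_of_rmax, e.peak_of_lt hy.pos hi]
      intro t ht hjt
      rcases Nat.lt_succ_iff_lt_or_eq.1 ht with ht | rfl
      · exact hle t hjt ht
      · rw [e.1, h3 j hj]
        unfold bump
        split_ifs <;> omega
  · rw [if_pos (h.reach_lt_peak hy), (e.isNext h).reach_eq, h.reach_eq, h3 t h.lt_length,
      peak_bump (by have := h.lt; omega) fun s hs => h3 s (hs.trans h.lt_length)]
    unfold bump
    split_ifs <;> omega

/-! ### Ordered partitions of the positions -/

/-- The left side describes cuts of the word into blocks with increasing letters; the right side
describes maps whose fibres are stacked in the interval order. That `f` is weakly increasing along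
positions need not be assumed on the right: it follows. -/
theorem layered_iff {n : ℕ} (y f : ℕ → ℕ) :
    ((∀ j < n, ∀ i ≤ j, f i ≤ f j) ∧ ∀ i < n, ∀ j < n, f i < f j → y i < y j) ↔
      ∀ i < n, ∀ j < n, f i < f j → reach n y i < y j := by
  classical
  constructor
  · rintro ⟨h1, h2⟩ i hi j hj hij
    -- The first position p in a later block carries a letter above `y i`, so the first larger
    -- letter t comes no later than p. All letters before t then lie in blocks up to that of i and
    -- are smaller than `y j`, which bounds `peak t y`.
    have hp : ∃ p, p < n ∧ f i < f p := ⟨j, hj, hij⟩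
    obtain ⟨hp1, hp2⟩ := Nat.find_spec hp
    have hp3 : ∀ s < Nat.find hp, f s ≤ f i := fun s hs => by
      have := Nat.find_min hp hs
      by_contra h
      exact this ⟨by omega, by omega⟩
    generalize Nat.find hp = p at hp1 hp2 hp3
    have hip : i < p := by
      by_contra h
      have := h1 i hi p (by omega)
      omega
    have hyp := h2 i hi p hp1 hp2
    rcases rmax_or_isNext n y i with h | ⟨t, h⟩
    · have := h p hp1 hip
      omega
    · have htp : t ≤ p := by
        by_contra h'
        have := h.between p hip (by omega)
        omega
      rw [h.reach_eq]
      refine (min_le_right _ _).trans_lt ?_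
      obtain ⟨s, hs, e⟩ := exists_eq_peak y (show 0 < t by have := h.lt; omega)
      rw [← e]
      exact h2 s (by omega) j hj ((hp3 s (by omega)).trans_lt hij)
  · intro h
    refine ⟨?_, fun i hi j hj hij => (le_reach y hi).trans_lt (h i hi j hj hij)⟩
    -- Induction on j from the right. If `f j < f i` with i ≤ j, then `reach n y j` is below `y i`,
    -- hence below the maximum before the next larger position t. By induction `f i ≤ f t`, so it is
    -- also below `y t`; but it is the minimum of these two numbers.
    have key : ∀ m, ∀ j < n, n - j ≤ m → ∀ i ≤ j, f i ≤ f j := by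
      intro m
      induction m with
      | zero => intro j hj hm; omega
      | succ m ih =>
        intro j hj hm i hij
        by_contra hf
        rw [not_le] at hf
        have hi : i < n := by omega
        have hb := h j hj i hi hf
        rcases rmax_or_isNext n y j with hr | ⟨t, ht⟩
        · rw [reach_of_rmax hr] at hb
          have := le_peak y hi
          omega
        · have h1 := ht.lt
          have h2 := ht.lt_length
          have h3 := ih t h2 (by omega) i (by omega)
          have h4 := h j hj t h2 (by omega)
          rw [ht.reach_eq] at h4 hb
          have := le_peak y (show i < t by omega)
          omega
    exact fun j hj => key _ j hj le_rfl

/-! ### Appending a letter to a sequence -/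

theorem getD_snoc_of_lt {z : List ℕ} (i : ℕ) {j : ℕ} (h : j < z.length) :
    (z ++ [i]).getD j 0 = z.getD j 0 := List.getD_append _ _ _ _ h

theorem getD_snoc_length (z : List ℕ) (i : ℕ) : (z ++ [i]).getD z.length 0 = i := by
  simp

theorem getD_map_of_lt {z : List ℕ} (f : ℕ → ℕ) {j : ℕ} (h : j < z.length) :
    (z.map f).getD j 0 = f (z.getD j 0) := by
  rw [List.getD_eq_getElem _ _ (by simpa using h), List.getD_eq_getElem _ _ h, List.getElem_map]

theorem last_eq_getD (z : List ℕ) : last z = z.getD (z.length - 1) 0 := by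
  unfold last
  rw [List.getLastD_eq_getLast?, List.getLast?_eq_getElem?, List.getD_eq_getElem?_getD]

theorem last_snoc (z : List ℕ) (i : ℕ) : last (z ++ [i]) = i := by
  simp [last]

theorem ascList_snoc {z : List ℕ} (hz : z ≠ []) (i : ℕ) :
    ascList (z ++ [i]) = ascList z ++ if last z < i then [z.length - 1] else [] := by
  have hpos := List.length_pos_iff.2 hz
  have h1 : (z ++ [i]).length - 1 = z.length - 1 + 1 := by simp; omega
  unfold ascList
  rw [h1, List.range_succ, List.filter_append]
  congr 1
  · refine List.filter_congr fun j hj => ?_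
    rw [List.mem_range] at hj
    rw [getD_snoc_of_lt i (by omega), getD_snoc_of_lt i (by omega)]
  · rw [List.filter_singleton, show z.length - 1 + 1 = z.length by omega, getD_snoc_length,
      getD_snoc_of_lt i (by omega), ← last_eq_getD]
    simp

theorem asc_snoc {z : List ℕ} (hz : z ≠ []) (i : ℕ) :
    asc (z ++ [i]) = asc z + if last z < i then 1 else 0 := by
  unfold asc
  rw [ascList_snoc hz, List.length_append]
  split_ifs <;> rfl

theorem asc_eq_card (x : List ℕ) :
    asc x = {j ∈ Finset.range (x.length - 1) | x.getD j 0 < x.getD (j + 1) 0}.card := by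
  unfold asc ascList
  rw [← List.toFinset_card_of_nodup (List.nodup_range.filter _), List.toFinset_filter,
    List.toFinset_range]
  simp

theorem isAscentSeq_snoc {z : List ℕ} (hz : z ≠ []) (i : ℕ) :
    IsAscentSeq (z ++ [i]) ↔ IsAscentSeq z ∧ i ≤ 1 + asc z := by
  have hpos := List.length_pos_iff.2 hz
  unfold IsAscentSeq
  rw [List.head?_append_of_ne_nil _ hz, List.length_append, List.length_singleton, and_assoc]
  refine and_congr_right fun _ => ?_
  constructor
  · intro h
    refine ⟨fun j hj hj' => ?_, ?_⟩
    · have := h j (by omega) hj'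
      rwa [getD_snoc_of_lt i hj, List.take_append_of_le_length hj.le] at this
    · have := h z.length (by omega) hpos
      rwa [getD_snoc_length, List.take_left] at this
  · rintro ⟨h, h'⟩ j hj hj'
    rcases Nat.lt_succ_iff_lt_or_eq.1 hj with hj | rfl
    · rw [getD_snoc_of_lt i hj, List.take_append_of_le_length hj.le]
      exact h j hj hj'
    · rwa [getD_snoc_length, List.take_left]

@[elab_as_elim]
theorem IsAscentSeq.induction {p : (x : List ℕ) → IsAscentSeq x → Prop} {x : List ℕ}
    (hx : IsAscentSeq x) (single : ∀ h, p [0] h)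
    (snoc : ∀ z i, z ≠ [] → ∀ (hz : IsAscentSeq z) (h : IsAscentSeq (z ++ [i])),
      i ≤ 1 + asc z → p z hz → p (z ++ [i]) h) : p x hx := by
  induction x using List.reverseRecOn with
  | nil => simp [IsAscentSeq] at hx
  | append_singleton z i ih =>
    rcases eq_or_ne z [] with rfl | hz
    · have : i = 0 := by simpa using hx.1
      subst this
      exact single _
    · have h := (isAscentSeq_snoc hz i).1 hx
      exact snoc z i hz h.1 hx h.2 (ih h.1)

/-! ### The modification algorithm -/

theorem length_modifyStep (y : List ℕ) (p : ℕ) : (modifyStep y p).length = y.length := by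
  simp [modifyStep]

theorem length_foldl_modifyStep (l y : List ℕ) : (l.foldl modifyStep y).length = y.length := by
  induction l generalizing y with
  | nil => rfl
  | cons p l ih => rw [List.foldl_cons, ih, length_modifyStep]

theorem length_modified (x : List ℕ) : (modified x).length = x.length :=
  length_foldl_modifyStep _ _

theorem modifyStep_snoc {y : List ℕ} (i : ℕ) {p : ℕ} (hp : p + 1 < y.length) :
    modifyStep (y ++ [i]) p = modifyStep y p ++ [i] := by
  unfold modifyStep
  rw [List.mapIdx_append, getD_snoc_of_lt i hp]
  simp [show ¬ y.length < p by omega]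

theorem foldl_modifyStep_snoc (l : List ℕ) {y : List ℕ} (i : ℕ) (hl : ∀ p ∈ l, p + 1 < y.length) :
    l.foldl modifyStep (y ++ [i]) = l.foldl modifyStep y ++ [i] := by
  induction l generalizing y with
  | nil => rfl
  | cons p l ih =>
    rw [List.foldl_cons, List.foldl_cons, modifyStep_snoc i (hl p (by simp)), ih]
    intro q hq
    rw [length_modifyStep]
    exact hl q (by simp [hq])

theorem modifyStep_last {y : List ℕ} (hy : y ≠ []) {i : ℕ} (hi : last y < i) :
    modifyStep (y ++ [i]) (y.length - 1) = y.map (bump i) ++ [i] := by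
  have hpos := List.length_pos_iff.2 hy
  rw [last_eq_getD] at hi
  unfold modifyStep
  rw [show y.length - 1 + 1 = y.length by omega, getD_snoc_length, List.mapIdx_append]
  congr 1
  · refine List.ext_getElem (by simp) fun j h1 h2 => ?_
    have hj : j < y.length := by simpa using h1
    simp only [List.getElem_mapIdx, List.getElem_map, bump]
    -- The pass only touches positions strictly left of the ascent, so it spares the last letter of
    -- `y`; `bump i` fixes that letter too, as it is below i.
    rcases eq_or_lt_of_le (show j ≤ y.length - 1 by omega) with rfl | hj'
    · rw [List.getD_eq_getElem _ _ hj] at hi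
      simp [hi]
    · simp [hj']
  · simp [show ¬ y.length < y.length - 1 by omega]

/-- The old passes never look at the new letter. The assumption `hlast` is needed because the ascent
test uses z while the final pass acts on `modified z`; `last_modified` discharges it by an induction
that uses this lemma. -/
theorem modified_snoc {z : List ℕ} (hz : z ≠ []) (i : ℕ) (hlast : last (modified z) = last z) :
    modified (z ++ [i]) =
      (if last z < i then (modified z).map (bump i) else modified z) ++ [i] := by
  have h : (ascList z).foldl modifyStep (z ++ [i]) = modified z ++ [i] := by
    refine foldl_modifyStep_snoc _ _ fun p hp => ?_
    have := List.mem_of_mem_filter hp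
    rw [List.mem_range] at this
    omega
  unfold modified at h ⊢
  rw [ascList_snoc hz, List.foldl_append, h]
  split_ifs with hi
  · have hne : modified z ≠ [] := by
      rw [← List.length_pos_iff, length_modified]
      exact List.length_pos_iff.2 hz
    rw [List.foldl_cons, List.foldl_nil, ← length_modified z]
    exact modifyStep_last hne (hlast ▸ hi)
  · rfl

theorem last_modified (x : List ℕ) : last (modified x) = last x := by
  induction x using List.reverseRecOn with
  | nil => rfl
  | append_singleton z i ih =>
    rcases eq_or_ne z [] with rfl | hz
    · rfl
    · rw [modified_snoc hz i ih, last_snoc, last_snoc]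

/-- The modified sequence, as a function on positions. -/
def modLetter (x : List ℕ) (j : ℕ) : ℕ := (modified x).getD j 0

theorem modLetter_last (x : List ℕ) : modLetter x (x.length - 1) = last x := by
  rw [← last_modified, last_eq_getD, length_modified, modLetter]

/-- The claims are proved together: the bound i ≤ 1 + asc z yields the bound by the peak required in
`Extends` only through the equality of peak and number of ascents. -/
theorem IsAscentSeq.modified_aux {x : List ℕ} (hx : IsAscentSeq x) :
    IsModifiedAscent x.length (modLetter x) ∧ peak x.length (modLetter x) = asc x ∧
      ∀ z i, z ≠ [] → x = z ++ [i] →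
        Extends z.length (modLetter z) (modLetter x) i := by
  induction hx using IsAscentSeq.induction with
  | single h =>
    refine ⟨⟨by simp, rfl, ?_, ?_⟩, rfl, ?_⟩
    · intro j hj c hc
      have : j = 0 := by simpa using hj
      subst this
      exact ⟨0, hj, by have : modLetter [0] 0 = 0 := rfl
                       omega⟩
    · intro j hj
      simp at hj
    · intro z i hz h
      have h1 := congrArg List.length h
      have := List.length_pos_iff.2 hz
      rw [List.length_append, List.length_singleton, List.length_singleton] at h1
      omega
  | snoc z i hz hx hx' hi ih =>
    obtain ⟨h1, h2, -⟩ := ih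
    have e : Extends z.length (modLetter z) (modLetter (z ++ [i])) i := by
      have hm := modified_snoc hz i (last_modified z)
      unfold Extends
      rw [modLetter_last, h2]
      unfold modLetter
      rw [hm]
      split_ifs with hlt
      · refine ⟨?_, Or.inl ⟨hlt, by omega, fun j hj => ?_⟩⟩
        · conv_lhs => rw [← length_modified z, ← List.length_map (bump i)]
          rw [getD_snoc_length]
        · rw [← length_modified] at hj
          rw [getD_snoc_of_lt i (by simpa using hj), getD_map_of_lt _ hj]
      · refine ⟨?_, Or.inr ⟨by omega, fun j hj => ?_⟩⟩
        · rw [← length_modified z, getD_snoc_length]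
        · rw [← length_modified] at hj
          rw [getD_snoc_of_lt i hj]
    refine ⟨?_, ?_, ?_⟩
    · rw [List.length_append]
      exact h1.extend e
    · rw [List.length_append, asc_snoc hz, ← modLetter_last]
      split_ifs with hlt
      · rw [← h2]; exact e.peak_of_lt h1.pos hlt
      · rw [← h2]; exact e.peak_of_le h1.pos (not_lt.1 hlt)
    · intro z' i' _ h
      obtain ⟨rfl, h'⟩ := List.append_inj' h rfl
      obtain rfl : i = i' := by simpa using h'
      exact e

theorem IsAscentSeq.isModifiedAscent {x : List ℕ} (hx : IsAscentSeq x) :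
    IsModifiedAscent x.length (modLetter x) := hx.modified_aux.1

theorem IsAscentSeq.peak_eq {x : List ℕ} (hx : IsAscentSeq x) :
    peak x.length (modLetter x) = asc x := hx.modified_aux.2.1

theorem IsAscentSeq.extends_snoc {z : List ℕ} {i : ℕ} (hz : z ≠ []) (hx : IsAscentSeq (z ++ [i])) :
    Extends z.length (modLetter z) (modLetter (z ++ [i])) i := hx.modified_aux.2.2 z i hz rfl

/-- Zeros survive modification because a letter that creates an ascent is positive, and bumping by a
positive letter neither creates nor destroys zeros. -/
theorem IsAscentSeq.zeros_eq {x : List ℕ} (hx : IsAscentSeq x) :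
    zeros x = {j ∈ Finset.range x.length | modLetter x j = 0}.card := by
  induction hx using IsAscentSeq.induction with
  | single h => rfl
  | snoc z i hz hx hx' hi ih =>
    have e := IsAscentSeq.extends_snoc hz hx'
    have h0 : {j ∈ Finset.range z.length | modLetter (z ++ [i]) j = 0} =
        {j ∈ Finset.range z.length | modLetter z j = 0} := by
      refine Finset.filter_congr fun j hj => ?_
      rw [Finset.mem_range] at hj
      rcases e.2 with ⟨h1, h2, h3⟩ | ⟨h1, h3⟩
      · rw [h3 j hj]
        unfold bump
        split_ifs with hj'
        · exact iff_of_false id (by omega)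
        · rfl
      · rw [h3 j hj]
    unfold zeros at ih ⊢
    rw [List.count_append, ih, List.length_append, List.length_singleton, Finset.range_add_one,
      Finset.filter_insert, e.1, h0]
    split_ifs with hi0
    · rw [Finset.card_insert_of_notMem (by simp), hi0]; simp
    · simp [hi0]

theorem IsAscentSeq.asc_eq {x : List ℕ} (hx : IsAscentSeq x) :
    asc x = {j ∈ Finset.range (x.length - 1) | modLetter x j < modLetter x (j + 1)}.card := by
  induction hx using IsAscentSeq.induction with
  | single h => rfl
  | snoc z i hz hx hx' hi ih =>
    have hpos := List.length_pos_iff.2 hz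
    have e := IsAscentSeq.extends_snoc hz hx'
    have h0 : {j ∈ Finset.range (z.length - 1) |
        modLetter (z ++ [i]) j < modLetter (z ++ [i]) (j + 1)} =
        {j ∈ Finset.range (z.length - 1) | modLetter z j < modLetter z (j + 1)} := by
      refine Finset.filter_congr fun j hj => ?_
      rw [Finset.mem_range] at hj
      exact e.lt_iff (by omega) (by omega)
    rw [asc_snoc hz, ih, List.length_append, List.length_singleton, Nat.add_sub_cancel]
    conv_rhs => rw [show z.length = z.length - 1 + 1 by omega, Finset.range_add_one,
      Finset.filter_insert, show z.length - 1 + 1 = z.length by omega, e.1,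
      h0]
    have hl := e.lt_letter_iff (show z.length - 1 < z.length by omega)
    rw [modLetter_last] at hl
    by_cases hi0 : last z < i
    · rw [if_pos hi0, if_pos (hl.2 hi0)]
      rw [Finset.card_insert_of_notMem (by simp)]
    · rw [if_neg hi0, if_neg (hl.not.2 hi0), Nat.add_zero]

/-! ### Components of sequences and permutations -/

/-- The word `y 0, …, y (n - 1)` is a concatenation of `k` nonempty blocks such that the letters
of each block are smaller than those of all the later blocks; the `i`-th letter is in block
number `f i`. -/
def Layered (k n : ℕ) (y : ℕ → ℕ) : Prop :=
  ∃ f : ℕ → ℕ, (∀ i < n, f i < k) ∧ (∀ c < k, ∃ i < n, f i = c) ∧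
    (∀ j < n, ∀ i ≤ j, f i ≤ f j) ∧ ∀ i < n, ∀ j < n, f i < f j → y i < y j

theorem layered_congr {n : ℕ} {y y' : ℕ → ℕ} (h : ∀ i < n, ∀ j < n, y i < y j ↔ y' i < y' j)
    (k : ℕ) : Layered k n y ↔ Layered k n y' := by
  unfold Layered
  refine exists_congr fun f => and_congr_right fun _ => and_congr_right fun _ =>
    and_congr_right fun _ => ?_
  exact forall₂_congr fun i hi => forall₂_congr fun j hj => by rw [h i hi j hj]

theorem layered_zero {n : ℕ} {y : ℕ → ℕ} : Layered 0 n y ↔ n = 0 := by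
  constructor
  · rintro ⟨f, h, -⟩
    by_contra hn
    exact absurd (h 0 (by omega)) (by omega)
  · rintro rfl
    exact ⟨id, by simp, by simp, by simp, by simp⟩

theorem layered_map_add (z : List ℕ) (c k : ℕ) :
    Layered k (z.map (· + c)).length (fun i => (z.map (· + c)).getD i 0) ↔
      Layered k z.length fun i => z.getD i 0 := by
  rw [List.length_map]
  refine layered_congr (fun i hi j hj => ?_) k
  rw [getD_map_of_lt _ hi, getD_map_of_lt _ hj]
  omega

theorem layered_succ {k : ℕ} {w : List ℕ} :
    Layered (k + 1) w.length (fun i => w.getD i 0) ↔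
      ∃ u v, u ≠ [] ∧ w = u ++ v ∧ (∀ a ∈ u, ∀ c ∈ v, a < c) ∧
        Layered k v.length fun i => v.getD i 0 := by
  classical
  constructor
  · rintro ⟨f, h1, h2, h3, h4⟩
    -- The length of the first block; the alternative `m = w.length` covers the case of a single
    -- block.
    have hex : ∃ m, m = w.length ∨ (m < w.length ∧ 0 < f m) := ⟨_, Or.inl rfl⟩
    have hm1 := Nat.find_spec hex
    have hm2 : ∀ i < Nat.find hex, i < w.length → f i = 0 := fun i hi hi' => by
      have := Nat.find_min hex hi
      by_contra h
      exact this (Or.inr ⟨hi', by omega⟩)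
    generalize Nat.find hex = m at hm1 hm2
    have hm : m ≤ w.length := by omega
    have hge : ∀ i, m ≤ i → i < w.length → 0 < f i := fun i hi hi' => by
      have := h3 i hi' m hi
      omega
    have hm0 : 0 < m := by
      obtain ⟨i, hi, hi'⟩ := h2 0 (by omega)
      by_contra h
      have := hge i (by omega) hi
      omega
    have hd : ∀ i, i < w.length - m → (w.drop m).getD i 0 = w.getD (m + i) 0 := fun i hi => by
      rw [List.getD_eq_getElem?_getD, List.getElem?_drop, List.getD_eq_getElem?_getD]
    refine ⟨w.take m, w.drop m, ?_, (List.take_append_drop m w).symm, ?_, ?_⟩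
    · rw [← List.length_pos_iff, List.length_take]
      omega
    · intro a ha c hc
      obtain ⟨i, hi, rfl⟩ := List.mem_iff_getElem.1 ha
      obtain ⟨j, hj, rfl⟩ := List.mem_iff_getElem.1 hc
      rw [List.length_take] at hi
      rw [List.length_drop] at hj
      have := h4 i (by omega) (m + j) (by omega)
        (by rw [hm2 i (by omega) (by omega)]; exact hge _ (by omega) (by omega))
      dsimp only at this
      rw [List.getElem_take, List.getElem_drop]
      rwa [List.getD_eq_getElem _ _ (by omega), List.getD_eq_getElem _ _ (by omega)] at this
    · rw [List.length_drop]
      refine ⟨fun i => f (m + i) - 1, fun i hi => ?_, fun c hc => ?_, fun j hj i hij => ?_,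
        fun i hi j hj hij => ?_⟩
      · dsimp only
        have := h1 (m + i) (by omega)
        have := hge (m + i) (by omega) (by omega)
        omega
      · obtain ⟨i, hi, hi'⟩ := h2 (c + 1) (by omega)
        have : m ≤ i := by
          by_contra h
          have := hm2 i (by omega) hi
          omega
        exact ⟨i - m, by omega, by dsimp only; rw [show m + (i - m) = i by omega, hi']; rfl⟩
      · dsimp only
        have := h3 (m + j) (by omega) (m + i) (by omega)
        omega
      · dsimp only at hij ⊢
        rw [hd i hi, hd j hj]
        exact h4 _ (by omega) _ (by omega) (by omega)
  · rintro ⟨u, v, hu, rfl, huv, f, h1, h2, h3, h4⟩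
    have hpos := List.length_pos_iff.2 hu
    rw [List.length_append]
    refine ⟨fun i => if i < u.length then 0 else f (i - u.length) + 1, fun i hi => ?_,
      fun c hc => ?_, fun j hj i hij => ?_, fun i hi j hj hij => ?_⟩
    · dsimp only
      split_ifs
      · omega
      · have := h1 (i - u.length) (by omega)
        omega
    · rcases Nat.eq_zero_or_pos c with rfl | hc0
      · exact ⟨0, by omega, by simp [hpos]⟩
      · obtain ⟨i, hi, hi'⟩ := h2 (c - 1) (by omega)
        refine ⟨u.length + i, by omega, ?_⟩
        simp only [show ¬ u.length + i < u.length by omega, if_false,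
          show u.length + i - u.length = i by omega]
        omega
    · dsimp only
      split_ifs
      · omega
      · omega
      · omega
      · have := h3 (j - u.length) (by omega) (i - u.length) (by omega)
        omega
    · dsimp only at hij ⊢
      split_ifs at hij with h5 h6 h6
      · omega
      · rw [List.getD_append _ _ _ _ h5, List.getD_append_right _ _ _ _ (by omega),
          List.getD_eq_getElem _ _ h5, List.getD_eq_getElem _ _ (by omega)]
        exact huv _ (List.getElem_mem _) _ (List.getElem_mem _)
      · omega
      · rw [List.getD_append_right _ _ _ _ (by omega), List.getD_append_right _ _ _ _ (by omega)]
        exact h4 _ (by omega) _ (by omega) (by omega)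

theorem le_maxLetter {a : ℕ} {y : List ℕ} (h : a ∈ y) : a ≤ maxLetter y := by
  unfold maxLetter
  induction y with
  | nil => simp at h
  | cons c y ih =>
    rw [List.foldr_cons]
    rcases List.mem_cons.1 h with rfl | h
    · exact le_max_left _ _
    · exact (ih h).trans (le_max_right _ _)

theorem maxLetter_mem {y : List ℕ} (h : y ≠ []) : maxLetter y ∈ y := by
  unfold maxLetter
  induction y with
  | nil => exact absurd rfl h
  | cons c y ih =>
    rw [List.foldr_cons]
    rcases eq_or_ne y [] with rfl | hy
    · simp
    · rcases max_choice c (y.foldr max 0) with h | h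
      · rw [h]; simp
      · rw [h]; exact List.mem_cons_of_mem _ (ih hy)

/-- The shift by 1 + max u is undone as soon as all letters of v exceed those of u, so a sum
decomposition is no more than a cut with increasing letters. -/
theorem isSeqSum_iff_layered {k : ℕ} {w : List ℕ} :
    IsSeqSum k w ↔ Layered k w.length fun i => w.getD i 0 := by
  induction k generalizing w with
  | zero =>
    rw [layered_zero, List.length_eq_zero_iff]
    constructor
    · rintro ⟨ys, h, -, rfl⟩
      rw [List.length_eq_zero_iff.1 h]; rfl
    · rintro rfl
      exact ⟨[], rfl, by simp, rfl⟩
  | succ k ih =>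
    rw [layered_succ]
    constructor
    · rintro ⟨ys, h1, h2, rfl⟩
      obtain ⟨y, ys, rfl⟩ := List.exists_cons_of_length_eq_add_one h1
      refine ⟨y, _, h2 y (by simp), rfl, ?_, ?_⟩
      · intro a ha c hc
        obtain ⟨d, -, rfl⟩ := List.mem_map.1 hc
        have := le_maxLetter ha
        omega
      · rw [layered_map_add, ← ih]
        exact ⟨ys, by simpa using h1, fun z hz => h2 z (by simp [hz]), rfl⟩
    · rintro ⟨u, v, hu, rfl, huv, hv⟩
      have hv' : v = (v.map (· - (1 + maxLetter u))).map (· + (1 + maxLetter u)) := by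
        rw [List.map_map]
        conv_lhs => rw [← List.map_id v]
        refine List.map_congr_left fun c hc => ?_
        have := huv _ (maxLetter_mem hu) c hc
        simp only [id, Function.comp]
        omega
      rw [hv', layered_map_add, ← ih] at hv
      obtain ⟨ys, h1, h2, h3⟩ := hv
      refine ⟨u :: ys, by simp [h1], ?_, ?_⟩
      · rintro y hy
        rcases List.mem_cons.1 hy with rfl | hy
        · exact hu
        · exact h2 y hy
      · rw [List.foldr_cons, h3, seqSum, ← hv']

theorem range'_split (m n : ℕ) :
    List.range' 1 (m + n) = List.range' 1 m ++ (List.range' 1 n).map (· + m) := by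
  have : (List.range' 1 n).map (· + m) = (List.range' 1 n).map (m + ·) :=
    List.map_congr_left fun a _ => Nat.add_comm a m
  rw [this, List.map_add_range', Nat.add_comm m 1, List.range'_append_1]

/-- Sorting the two parts separately gives a sorted word, which must be 1, 2, …; cutting it at the
length of u identifies both parts. -/
theorem perm_of_perm_append {u v : List ℕ} (h : (u ++ v).Perm (List.range' 1 (u ++ v).length))
    (huv : ∀ a ∈ u, ∀ c ∈ v, a < c) :
    u.Perm (List.range' 1 u.length) ∧ v.Perm ((List.range' 1 v.length).map (· + u.length)) := by
  have hs : (u.insertionSort (· ≤ ·) ++ v.insertionSort (· ≤ ·)) =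
      List.range' 1 (u ++ v).length := by
    refine List.Perm.eq_of_pairwise' (r := (· ≤ ·)) ?_ ?_ ?_
    · rw [List.pairwise_append]
      refine ⟨List.pairwise_insertionSort _ _, List.pairwise_insertionSort _ _, ?_⟩
      intro a ha c hc
      exact (huv a ((List.mem_insertionSort _).1 ha) c ((List.mem_insertionSort _).1 hc)).le
    · exact List.pairwise_le_range'
    · exact ((List.perm_insertionSort _ _).append (List.perm_insertionSort _ _)).trans h
  rw [List.length_append, range'_split] at hs
  obtain ⟨h1, h2⟩ := List.append_inj hs (by simp)
  rw [← h1, ← h2]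
  exact ⟨(List.perm_insertionSort _ _).symm, (List.perm_insertionSort _ _).symm⟩

theorem isPermSum_iff_layered {k : ℕ} {w : List ℕ} :
    IsPermSum k w ↔
      w.Perm (List.range' 1 w.length) ∧ Layered k w.length fun i => w.getD i 0 := by
  induction k generalizing w with
  | zero =>
    rw [layered_zero, List.length_eq_zero_iff]
    constructor
    · rintro ⟨ys, h, -, rfl⟩
      rw [List.length_eq_zero_iff.1 h]; exact ⟨List.Perm.refl _, rfl⟩
    · rintro ⟨-, rfl⟩
      exact ⟨[], rfl, by simp, rfl⟩
  | succ k ih =>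
    rw [layered_succ]
    constructor
    · rintro ⟨ys, h1, h2, rfl⟩
      obtain ⟨y, ys, rfl⟩ := List.exists_cons_of_length_eq_add_one h1
      have hy := h2 y (by simp)
      obtain ⟨h3, h4⟩ := (ih (w := ys.foldr permSum [])).1
        ⟨ys, by simpa using h1, fun z hz => h2 z (by simp [hz]), rfl⟩
      rw [List.foldr_cons]
      refine ⟨?_, y, _, hy.1, rfl, ?_, ?_⟩
      · unfold permSum
        rw [List.length_append, List.length_map, range'_split]
        exact hy.2.append (h3.map _)
      · intro a ha c hc
        obtain ⟨d, hd, rfl⟩ := List.mem_map.1 hc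
        have h5 := hy.2.subset ha
        have h6 := h3.subset hd
        rw [List.mem_range'_1] at h5 h6
        omega
      · rwa [layered_map_add]
    · rintro ⟨hw, u, v, hu, rfl, huv, hv⟩
      obtain ⟨h1, h2⟩ := perm_of_perm_append hw huv
      have hv' : v = (v.map (· - u.length)).map (· + u.length) := by
        rw [List.map_map]
        conv_lhs => rw [← List.map_id v]
        refine List.map_congr_left fun c hc => ?_
        obtain ⟨d, -, rfl⟩ := List.mem_map.1 (h2.subset hc)
        simp
      rw [hv', layered_map_add] at hv
      have h3 : (v.map (· - u.length)).Perm (List.range' 1 (v.map (· - u.length)).length) := by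
        have := h2.map (· - u.length)
        rw [List.map_map] at this
        simpa [Function.comp_def] using this
      obtain ⟨ys, h4, h5, h6⟩ := ih.2 ⟨h3, hv⟩
      refine ⟨u :: ys, by simp [h4], ?_, ?_⟩
      · rintro y hy
        rcases List.mem_cons.1 hy with rfl | hy
        · exact ⟨hu, h1⟩
        · exact h5 y hy
      · rw [List.foldr_cons, h6, permSum, ← hv']

/-! ### Permutation words -/

/-- `w` is the one-line notation of a permutation of `1, …, n`. -/
def IsPermWord (n : ℕ) (w : List ℕ) : Prop := w.Perm (List.range' 1 n)

namespace IsPermWord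

variable {n : ℕ} {w : List ℕ}

theorem length_eq (h : IsPermWord n w) : w.length = n := by
  simpa using List.Perm.length_eq h

theorem nodup (h : IsPermWord n w) : w.Nodup := (List.Perm.nodup_iff h).2 (List.nodup_range' ..)

theorem mem_iff (h : IsPermWord n w) {a : ℕ} : a ∈ w ↔ 1 ≤ a ∧ a ≤ n := by
  rw [List.Perm.mem_iff h, List.mem_range'_1]
  omega

theorem getD_mem (h : IsPermWord n w) {p : ℕ} (hp : p < n) : w.getD p 0 ∈ w := by
  rw [List.getD_eq_getElem _ _ (by rwa [h.length_eq])]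
  exact List.getElem_mem _

theorem one_le (h : IsPermWord n w) {p : ℕ} (hp : p < n) : 1 ≤ w.getD p 0 :=
  (h.mem_iff.1 (h.getD_mem hp)).1

theorem le (h : IsPermWord n w) {p : ℕ} (hp : p < n) : w.getD p 0 ≤ n :=
  (h.mem_iff.1 (h.getD_mem hp)).2

theorem getD_inj (h : IsPermWord n w) {p q : ℕ} (hp : p < n) (hq : q < n) :
    w.getD p 0 = w.getD q 0 ↔ p = q := by
  have hl := h.length_eq
  rw [List.getD_eq_getElem _ _ (by omega), List.getD_eq_getElem _ _ (by omega)]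
  exact h.nodup.getElem_inj_iff

theorem exists_getD (h : IsPermWord n w) {a : ℕ} (h1 : 1 ≤ a) (h2 : a ≤ n) :
    ∃ p < n, w.getD p 0 = a := by
  obtain ⟨p, hp, e⟩ := List.mem_iff_getElem.1 (h.mem_iff.2 ⟨h1, h2⟩)
  exact ⟨p, by rwa [h.length_eq] at hp, by rw [List.getD_eq_getElem _ _ hp, e]⟩

/-- Carries statistics of the word over to the sequence: the letter a stands for the zero-based
index a - 1. -/
theorem sum_eq (h : IsPermWord n w) {M : Type*} [AddCommMonoid M] (f : ℕ → M) :
    ∑ p ∈ Finset.range n, f (w.getD p 0 - 1) = ∑ j ∈ Finset.range n, f j := by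
  refine Finset.sum_bij (fun p _ => w.getD p 0 - 1) ?_ ?_ ?_ fun _ _ => rfl
  · intro p hp
    rw [Finset.mem_range] at hp ⊢
    have := h.one_le hp
    have := h.le hp
    omega
  · intro p hp q hq e
    rw [Finset.mem_range] at hp hq
    have := h.one_le hp
    have := h.one_le hq
    exact (h.getD_inj hp hq).1 (by omega)
  · intro j hj
    rw [Finset.mem_range] at hj
    obtain ⟨p, hp, e⟩ := h.exists_getD (show 1 ≤ j + 1 by omega) (by omega)
    exact ⟨p, Finset.mem_range.2 hp, by rw [e]; rfl⟩

theorem card_eq (h : IsPermWord n w) (p : ℕ → Prop) [DecidablePred p] :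
    {q ∈ Finset.range n | p (w.getD q 0 - 1)}.card = {j ∈ Finset.range n | p j}.card := by
  rw [Finset.card_filter, Finset.card_filter]
  exact h.sum_eq fun j => if p j then 1 else 0

theorem erase (h : IsPermWord (n + 1) w) : IsPermWord n (w.erase (n + 1)) := by
  have := List.Perm.erase (n + 1) h
  unfold IsPermWord
  refine this.trans ?_
  rw [List.range'_concat, List.erase_append_right]
  · simp [Nat.add_comm]
  · rw [List.mem_range'_1]; omega

theorem idxOf_lt (h : IsPermWord (n + 1) w) : w.idxOf (n + 1) < n + 1 := by
  have := List.idxOf_lt_length_of_mem (h.mem_iff.2 (show 1 ≤ n + 1 ∧ n + 1 ≤ n + 1 by omega))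
  rwa [h.length_eq] at this

theorem getD_idxOf (h : IsPermWord (n + 1) w) : w.getD (w.idxOf (n + 1)) 0 = n + 1 := by
  have := h.idxOf_lt
  rw [List.getD_eq_getElem _ _ (by rwa [h.length_eq]), List.getElem_idxOf]

theorem insertIdx_erase (h : IsPermWord (n + 1) w) :
    (w.erase (n + 1)).insertIdx (w.idxOf (n + 1)) (n + 1) = w := by
  have := h.idxOf_lt
  rw [← List.eraseIdx_idxOf_eq_erase, List.insertIdx_eraseIdx_self (by rw [h.length_eq]; omega)]
  refine List.ext_getElem (by simp) fun j h1 h2 => ?_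
  rw [List.getElem_set]
  split_ifs with hj
  · subst hj
    rw [List.getElem_idxOf]
  · rfl

end IsPermWord

theorem getD_insertIdx (w : List ℕ) {p : ℕ} (hp : p ≤ w.length) (c j : ℕ) :
    (w.insertIdx p c).getD j 0 =
      if j < p then w.getD j 0 else if j = p then c else w.getD (j - 1) 0 := by
  rw [List.getD_eq_getElem?_getD, List.getElem?_insertIdx]
  split_ifs with h1 h2 h3
  · rw [List.getD_eq_getElem?_getD]
  · rfl
  · omega
  · rw [List.getD_eq_getElem?_getD]

theorem avoids_iff (w : List ℕ) :
    Avoids w ↔ ∀ i, i + 1 < w.length → w.getD i 0 < w.getD (i + 1) 0 →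
      ∀ k < w.length, i + 1 < k → w.getD i 0 ≠ w.getD k 0 + 1 := by
  unfold Avoids
  constructor
  · intro h i hi hlt k hk hik e
    rcases h k hk (i + 1) hik i (by omega) ⟨by omega, hlt⟩ with h | h
    · exact h rfl
    · exact h e
  · intro h k hk j hj i hi hlt
    by_contra hc
    push Not at hc
    obtain ⟨rfl, e⟩ := hc
    exact h i (by omega) hlt.2 k hk hj e

/-- The only ascent created by the insertion has the new maximum as its top. If the insertion
separates an old ascent, its bottom is now followed by the new maximum, so no old constraint is
lost. -/
theorem avoids_insertIdx_iff {m : ℕ} {w : List ℕ} (hw : IsPermWord m w) {p : ℕ} (hp : p ≤ m) :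
    Avoids (w.insertIdx p (m + 1)) ↔
      Avoids w ∧ ∀ r, r + 1 = p → ∀ q, r < q → q < m → w.getD r 0 ≠ w.getD q 0 + 1 := by
  have hl := hw.length_eq
  rw [avoids_iff, avoids_iff, List.length_insertIdx_of_le_length (by omega), hl]
  simp only [getD_insertIdx w (show p ≤ w.length by omega)]
  constructor
  · intro h
    constructor
    · intro i hi hlt k hk hik
      have hle := hw.le (show i < m by omega)
      rcases lt_or_ge i p with hip | hip
      · have h1 := h i (by omega)
        rw [if_pos hip] at h1
        have h2 : w.getD i 0 <
            if i + 1 < p then w.getD (i + 1) 0 else if i + 1 = p then m + 1 else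
              w.getD (i + 1 - 1) 0 := by
          split_ifs
          · exact hlt
          · omega
          · omega
        rcases lt_or_ge k p with hkp | hkp
        · have := h1 h2 k (by omega) hik
          rwa [if_pos hkp] at this
        · have := h1 h2 (k + 1) (by omega) (by omega)
          rwa [if_neg (by omega), if_neg (by omega)] at this
      · have := h (i + 1) (by omega)
        rw [if_neg (by omega), if_neg (by omega), if_neg (by omega), if_neg (by omega)] at this
        have := this hlt (k + 1) (by omega) (by omega)
        rwa [if_neg (by omega), if_neg (by omega)] at this
    · rintro r rfl q hq hqm
      have := h r (by omega)
      rw [if_pos (by omega), if_neg (by omega), if_pos rfl] at this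
      have := this (by have := hw.le (show r < m by omega); omega) (q + 1) (by omega) (by omega)
      rwa [if_neg (by omega), if_neg (by omega)] at this
  · rintro ⟨h, h'⟩ i hi hlt k hk hik
    rcases lt_trichotomy (i + 1) p with hip | rfl | hip
    · rw [if_pos (by omega), if_pos hip] at hlt
      rw [if_pos (by omega)]
      have hle := hw.le (show i < m by omega)
      split_ifs with h1 h2
      · exact h i (by omega) hlt k (by omega) hik
      · omega
      · exact h i (by omega) hlt (k - 1) (by omega) (by omega)
    · rw [if_pos (by omega), if_neg (by omega), if_neg (by omega)]
      exact h' i rfl (k - 1) (by omega) (by omega)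
    · rcases eq_or_lt_of_le (Nat.lt_succ_iff.1 hip) with rfl | hip'
      · rw [if_neg (by omega), if_pos rfl, if_neg (by omega), if_neg (by omega)] at hlt
        have := hw.le (show p + 1 - 1 < m by omega)
        omega
      · rw [if_neg (by omega), if_neg (by omega), if_neg (by omega), if_neg (by omega)] at hlt
        rw [if_neg (by omega), if_neg (by omega), if_neg (by omega), if_neg (by omega)]
        have := h (i - 1) (by omega)
        rw [show i - 1 + 1 = i + 1 - 1 by omega] at this
        exact this hlt (k - 1) (by omega) (by omega)

/-! ### Sorting the indices of a modified ascent sequence -/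

/-- The letter `a` is at most `c` in the order by increasing value of `y`, with ties broken in
decreasing order. The letter `a` has index `a - 1`. -/
def Before (y : ℕ → ℕ) (a c : ℕ) : Prop :=
  y (a - 1) < y (c - 1) ∨ (y (a - 1) = y (c - 1) ∧ c ≤ a)

/-- The word `w` lists `1, …, n` in the order given by `y`. -/
structure SortedBy (n : ℕ) (y : ℕ → ℕ) (w : List ℕ) : Prop where
  isPermWord : IsPermWord n w
  pairwise : w.Pairwise (Before y)

theorem exists_sortedBy (n : ℕ) (y : ℕ → ℕ) : ∃ w, SortedBy n y w := by
  classical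
  have : Std.Total (Before y) := ⟨fun a c => by unfold Before; omega⟩
  have : IsTrans ℕ (Before y) := ⟨fun a c d => by unfold Before; omega⟩
  exact ⟨(List.range' 1 n).insertionSort (Before y), List.perm_insertionSort _ _,
    List.pairwise_insertionSort _ _⟩

theorem SortedBy.unique {n : ℕ} {y : ℕ → ℕ} {w w' : List ℕ} (h : SortedBy n y w)
    (h' : SortedBy n y w') : w = w' := by
  have : Std.Antisymm (Before y) := ⟨fun a c => by unfold Before; omega⟩
  exact List.Perm.eq_of_pairwise' h.pairwise h'.pairwise
    (h.isPermWord.trans (List.Perm.symm h'.isPermWord))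

theorem SortedBy.congr {n : ℕ} {y y' : ℕ → ℕ} {w : List ℕ} (h : SortedBy n y w)
    (hlt : ∀ i < n, ∀ j < n, y' i < y' j ↔ y i < y j) : SortedBy n y' w := by
  refine ⟨h.isPermWord, h.pairwise.imp_of_mem fun {a c} ha hc hac => ?_⟩
  rw [h.isPermWord.mem_iff] at ha hc
  have h1 := hlt (a - 1) (by omega) (c - 1) (by omega)
  have h2 := hlt (c - 1) (by omega) (a - 1) (by omega)
  unfold Before at *
  omega

/-- The number of letters smaller than `c`. -/
def cutPos (n : ℕ) (y : ℕ → ℕ) (c : ℕ) : ℕ := {j ∈ Finset.range n | y j < c}.card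

theorem iff_lt_card_of_downward_closed {n : ℕ} {p : ℕ → Prop} [DecidablePred p]
    (h : ∀ q < n, ∀ r ≤ q, p q → p r) {q : ℕ} (hq : q < n) :
    p q ↔ q < {r ∈ Finset.range n | p r}.card := by
  constructor
  · intro hpq
    have : Finset.range (q + 1) ⊆ {r ∈ Finset.range n | p r} := by
      intro r hr
      rw [Finset.mem_range] at hr
      rw [Finset.mem_filter, Finset.mem_range]
      exact ⟨by omega, h q hq r (by omega) hpq⟩
    simpa using Finset.card_le_card this
  · intro hlt
    by_contra hpq
    have : {r ∈ Finset.range n | p r} ⊆ Finset.range q := by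
      intro r hr
      rw [Finset.mem_filter, Finset.mem_range] at hr
      rw [Finset.mem_range]
      by_contra hrq
      exact hpq (h r hr.1 q (by omega) hr.2)
    have := Finset.card_le_card this
    rw [Finset.card_range] at this
    omega

theorem cutPos_le (n : ℕ) (y : ℕ → ℕ) (c : ℕ) : cutPos n y c ≤ n := by
  exact (Finset.card_filter_le _ _).trans_eq (Finset.card_range n)

theorem cutPos_zero (n : ℕ) (y : ℕ → ℕ) : cutPos n y 0 = 0 := by
  simp [cutPos]

theorem cutPos_peak (n : ℕ) (y : ℕ → ℕ) : cutPos n y (peak n y + 1) = n := by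
  unfold cutPos
  rw [Finset.filter_true_of_mem, Finset.card_range]
  intro j hj
  exact Nat.lt_succ_of_le (le_peak y (Finset.mem_range.1 hj))

/-- No block is empty: c is at most the peak and hence occurs as a letter. -/
theorem IsModifiedAscent.cutPos_lt {n : ℕ} {y : ℕ → ℕ} (hy : IsModifiedAscent n y) {c d : ℕ}
    (hcd : c < d) (hd : d ≤ peak n y + 1) : cutPos n y c < cutPos n y d := by
  obtain ⟨l, hl, rfl⟩ := hy.exists_eq (show c ≤ peak n y by omega)
  refine Finset.card_lt_card (Finset.ssubset_iff_of_subset ?_ |>.2 ⟨l, ?_, ?_⟩)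
  · exact Finset.monotone_filter_right _ fun j _ hj => hj.trans hcd
  · simpa using ⟨hl, hcd⟩
  · simp

theorem IsModifiedAscent.cutPos_lt_iff {n : ℕ} {y : ℕ → ℕ} (hy : IsModifiedAscent n y) {c d : ℕ}
    (hc : c ≤ peak n y + 1) (hd : d ≤ peak n y + 1) : cutPos n y c < cutPos n y d ↔ c < d := by
  refine ⟨fun h => ?_, fun h => hy.cutPos_lt h hd⟩
  by_contra hcd
  rcases eq_or_lt_of_le (not_lt.1 hcd) with rfl | h'
  · omega
  · have := hy.cutPos_lt h' hc
    omega

namespace SortedBy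

variable {n : ℕ} {y : ℕ → ℕ} {w : List ℕ}

theorem before (h : SortedBy n y w) {p q : ℕ} (hpq : p < q) (hq : q < n) :
    y (w.getD p 0 - 1) < y (w.getD q 0 - 1) ∨
      (y (w.getD p 0 - 1) = y (w.getD q 0 - 1) ∧ w.getD q 0 < w.getD p 0) := by
  have hl := h.isPermWord.length_eq
  have h1 := List.pairwise_iff_getElem.1 h.pairwise p q (by omega) (by omega) hpq
  have h2 := (h.isPermWord.getD_inj (hpq.trans hq) hq).not.2 hpq.ne
  rw [← List.getD_eq_getElem _ 0, ← List.getD_eq_getElem _ 0] at h1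
  unfold Before at h1
  omega

theorem key_mono (h : SortedBy n y w) {p q : ℕ} (hpq : p ≤ q) (hq : q < n) :
    y (w.getD p 0 - 1) ≤ y (w.getD q 0 - 1) := by
  rcases hpq.eq_or_lt with rfl | hpq
  · exact le_rfl
  · have := h.before hpq hq
    omega

theorem key_lt_iff (h : SortedBy n y w) {q : ℕ} (hq : q < n) (c : ℕ) :
    y (w.getD q 0 - 1) < c ↔ q < cutPos n y c := by
  unfold cutPos
  rw [← h.isPermWord.card_eq fun j => y j < c]
  exact iff_lt_card_of_downward_closed
    (p := fun q => y (w.getD q 0 - 1) < c) (fun q hq r hr hc => (h.key_mono hr hq).trans_lt hc) hq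

/-- Put a = `w.getD p 0`. For a > 1, the sorting places a - 1 before a exactly when `y` has an
ascent from index a - 2 to index a - 1, and ascent tops are first occurrences. For a = 1 both sides
hold trivially. -/
theorem pred_not_after_iff (h : SortedBy n y w) (hy : IsModifiedAscent n y) {p : ℕ} (hp : p < n) :
    (∀ q, p < q → q < n → w.getD p 0 ≠ w.getD q 0 + 1) ↔
      ∀ l < w.getD p 0 - 1, y l ≠ y (w.getD p 0 - 1) := by
  have hw := h.isPermWord
  have h1 := hw.one_le hp
  have h2 := hw.le hp
  constructor
  · intro hq
    rcases h1.eq_or_lt with h1 | h1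
    · rw [← h1]; intro l hl; omega
    · obtain ⟨r, hr, e⟩ := hw.exists_getD (show 1 ≤ w.getD p 0 - 1 by omega) (by omega)
      rcases lt_trichotomy p r with hpr | rfl | hpr
      · exact absurd (by omega) (hq r hpr hr)
      · omega
      · have h3 := h.before hpr hp
        rw [e] at h3
        have h4 := hy.first (w.getD p 0 - 1 - 1) (by omega)
        rw [show w.getD p 0 - 1 - 1 + 1 = w.getD p 0 - 1 by omega] at h4
        intro l hl
        exact h4.1 (by omega) l (by omega)
  · intro hf q hpq hq e
    have h3 := h.before hpq hq
    have h4 := hw.one_le hq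
    have h5 := hy.first (w.getD q 0 - 1) (by omega)
    rw [show w.getD q 0 - 1 + 1 = w.getD p 0 - 1 by omega] at h5
    have h6 := h5.2 fun l hl => hf l (by omega)
    omega

/-- Blocks are decreasing, so the smallest index with a given key, its first occurrence, ends its
block. -/
theorem first_iff (h : SortedBy n y w) {p : ℕ} (hp : p + 1 < n) :
    (∀ l < w.getD p 0 - 1, y l ≠ y (w.getD p 0 - 1)) ↔
      y (w.getD p 0 - 1) < y (w.getD (p + 1) 0 - 1) := by
  have hw := h.isPermWord
  have h1 := h.before (show p < p + 1 by omega) hp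
  have h2 := hw.one_le hp
  constructor
  · intro hf
    by_contra hc
    exact hf (w.getD (p + 1) 0 - 1) (by omega) (by omega)
  · intro hlt l hl e
    have h3 := hw.le (show p < n by omega)
    obtain ⟨r, hr, e'⟩ := hw.exists_getD (show 1 ≤ l + 1 by omega) (by omega)
    have e2 : w.getD r 0 - 1 = l := by omega
    rcases lt_trichotomy r p with hrp | rfl | hrp
    · have := h.before hrp (by omega)
      rw [e2] at this
      omega
    · omega
    · have := h.key_mono (show p + 1 ≤ r by omega) hr
      rw [e2] at this
      omega

theorem avoids (h : SortedBy n y w) (hy : IsModifiedAscent n y) : Avoids w := by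
  have hl := h.isPermWord.length_eq
  rw [avoids_iff, hl]
  intro i hi hlt k hk hik
  refine (h.pred_not_after_iff hy (by omega)).2 ((h.first_iff hi).2 ?_) k (by omega) hk
  have := h.before (show i < i + 1 by omega) hi
  omega

/-- A site with neighbours on both sides is active exactly when the letter on its left is not
followed later by its predecessor, which by `pred_not_after_iff` and `first_iff` means that the
letter ends its block. -/
theorem isActive_iff (h : SortedBy n y w) (hy : IsModifiedAscent n y) {p : ℕ} :
    IsActive w p ↔ ∃ c ≤ peak n y + 1, cutPos n y c = p := by
  have hw := h.isPermWord
  have hl := hw.length_eq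
  unfold IsActive
  rw [hl]
  constructor
  · rintro ⟨hp, ha⟩
    rw [avoids_insertIdx_iff hw hp] at ha
    rcases Nat.eq_zero_or_pos p with rfl | hp0
    · exact ⟨0, by omega, cutPos_zero n y⟩
    rcases hp.eq_or_lt with rfl | hp
    · exact ⟨_, le_rfl, cutPos_peak p y⟩
    obtain ⟨r, rfl⟩ : ∃ r, p = r + 1 := ⟨p - 1, by omega⟩
    have h1 := (h.first_iff hp).1 ((h.pred_not_after_iff hy (by omega)).1 (ha.2 r rfl))
    have h2 := (h.key_lt_iff (show r < n by omega) _).1 h1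
    have h3 := (h.key_lt_iff hp (y (w.getD (r + 1) 0 - 1))).not.1 (lt_irrefl _)
    refine ⟨y (w.getD (r + 1) 0 - 1), ?_, by omega⟩
    have := hw.le hp
    exact (le_peak y (by omega)).trans (Nat.le_succ _)
  · rintro ⟨c, hc, rfl⟩
    refine ⟨cutPos_le n y c, (avoids_insertIdx_iff hw (cutPos_le n y c)).2 ⟨h.avoids hy, ?_⟩⟩
    intro r hr q hrq hq
    refine (h.pred_not_after_iff hy (by omega)).2 ((h.first_iff (by omega)).2 ?_) q hrq hq
    have h1 := (h.key_lt_iff (show r < n by omega) c).2 (by omega)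
    have h2 := (h.key_lt_iff (show r + 1 < n by omega) c).not.2 (by omega)
    omega

theorem siteLabel_cutPos (h : SortedBy n y w) (hy : IsModifiedAscent n y) {c : ℕ}
    (hc : c ≤ peak n y + 1) : siteLabel w (cutPos n y c) = c := by
  unfold siteLabel
  have : {r ∈ Finset.range (cutPos n y c) | IsActive w r} =
      (Finset.range c).image (cutPos n y) := by
    ext r
    rw [Finset.mem_filter, Finset.mem_range, Finset.mem_image, h.isActive_iff hy]
    constructor
    · rintro ⟨h1, d, hd, rfl⟩
      exact ⟨d, Finset.mem_range.2 ((hy.cutPos_lt_iff hd hc).1 h1), rfl⟩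
    · rintro ⟨d, hd, rfl⟩
      rw [Finset.mem_range] at hd
      exact ⟨hy.cutPos_lt hd hc, d, by omega, rfl⟩
  rw [this, Finset.card_image_of_injOn, Finset.card_range]
  intro d hd e he hde
  simp only [Finset.coe_range, Set.mem_Iio] at hd he
  by_contra hne
  rcases lt_or_gt_of_ne hne with hlt | hlt
  · have := hy.cutPos_lt hlt (by omega)
    omega
  · have := hy.cutPos_lt hlt (by omega)
    omega

/-- An inequality suffices: it puts all keys in the summation range of `delta`, and superfluous
terms vanish. -/
theorem le_numActive (h : SortedBy n y w) (hy : IsModifiedAscent n y) :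
    peak n y + 1 ≤ numActive w := by
  have h1 := h.siteLabel_cutPos hy le_rfl
  rw [← h1]
  unfold siteLabel numActive
  refine Finset.card_le_card (Finset.filter_subset_filter _ ?_)
  rw [h.isPermWord.length_eq]
  refine Finset.range_subset_range.2 ?_
  have := cutPos_le n y (peak n y + 1)
  omega

theorem entryBetween_iff (h : SortedBy n y w) (hy : IsModifiedAscent n y) {i p : ℕ} (hp : p < n) :
    EntryBetween w i p ↔ y (w.getD p 0 - 1) = i := by
  unfold EntryBetween
  constructor
  · rintro ⟨s, t, hs, hs', ht, ht', h1, h2⟩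
    obtain ⟨c, hc, rfl⟩ := (h.isActive_iff hy).1 hs
    obtain ⟨d, hd, rfl⟩ := (h.isActive_iff hy).1 ht
    rw [h.siteLabel_cutPos hy hc] at hs'
    rw [h.siteLabel_cutPos hy hd] at ht'
    have h3 := (h.key_lt_iff hp c).not.2 (by omega)
    have h4 := (h.key_lt_iff hp d).2 h2
    omega
  · rintro rfl
    have h0 : y (w.getD p 0 - 1) ≤ peak n y := by
      have := h.isPermWord.le hp
      have := h.isPermWord.one_le hp
      exact le_peak y (by omega)
    refine ⟨_, _, (h.isActive_iff hy).2 ⟨_, by omega, rfl⟩, h.siteLabel_cutPos hy (by omega),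
      (h.isActive_iff hy).2 ⟨_, by omega, rfl⟩, h.siteLabel_cutPos hy (by omega), ?_, ?_⟩
    · exact not_lt.1 ((h.key_lt_iff hp _).not.1 (lt_irrefl _))
    · exact (h.key_lt_iff hp _).1 (Nat.lt_succ_self _)

/-! ### Statistics of the sorted word -/

/-- The first block is the decreasing block of key 0 and ends with the letter 1, after which no
further minimum can occur. -/
theorem lmin_eq (h : SortedBy n y w) (hy : IsModifiedAscent n y) :
    lmin w = {j ∈ Finset.range n | y j = 0}.card := by
  have hw := h.isPermWord
  rw [← hw.card_eq fun j => y j = 0]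
  unfold lmin
  rw [hw.length_eq]
  congr 1
  refine Finset.filter_congr fun p hp => ?_
  rw [Finset.mem_range] at hp
  have hp1 := hw.one_le hp
  constructor
  · intro hmin
    obtain ⟨r, hr, e⟩ := hw.exists_getD (le_refl 1) hy.pos
    rcases lt_or_ge r p with hrp | hrp
    · have h1 := hmin r hrp
      rw [show w.getD p 0 - 1 = 0 by omega]
      exact hy.zero
    · have := h.key_mono hrp hr
      rw [e, Nat.sub_self, hy.zero] at this
      omega
  · intro h0 q hq
    have := h.before hq hp
    omega

theorem rmax_iff (h : SortedBy n y w) {p : ℕ} (hp : p < n) :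
    (∀ q < n, p < q → w.getD q 0 ≤ w.getD p 0) ↔
      ∀ l < n, w.getD p 0 - 1 < l → y l ≤ y (w.getD p 0 - 1) := by
  have hw := h.isPermWord
  have hp1 := hw.one_le hp
  constructor
  · intro hmax l hl hlt
    obtain ⟨q, hq, e⟩ := hw.exists_getD (show 1 ≤ l + 1 by omega) (by omega)
    have hqp : q ≤ p := by
      by_contra hc
      have := hmax q hq (by omega)
      omega
    have := h.key_mono hqp hp
    rwa [e, Nat.add_sub_cancel] at this
  · intro hmax q hq hpq
    by_contra hc
    have h1 := hmax (w.getD q 0 - 1) (by have := hw.le hq; have := hw.one_le hq; omega) (by omega)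
    have h2 := h.before hpq hq
    omega

theorem rmaxPos_eq (h : SortedBy n y w) :
    rmaxPos w = {p ∈ Finset.range n |
      ∀ l < n, w.getD p 0 - 1 < l → y l ≤ y (w.getD p 0 - 1)} := by
  unfold rmaxPos
  rw [h.isPermWord.length_eq]
  exact Finset.filter_congr fun p hp => h.rmax_iff (Finset.mem_range.1 hp)

theorem rmax_eq (h : SortedBy n y w) :
    rmax w = {j ∈ Finset.range n | ∀ l < n, j < l → y l ≤ y j}.card := by
  unfold rmax
  rw [h.rmaxPos_eq]
  exact h.isPermWord.card_eq fun j => ∀ l < n, j < l → y l ≤ y j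

/-- The largest letter has the largest index, so it opens its block. -/
theorem idxOf_eq {m : ℕ} (h : SortedBy (m + 1) y w) :
    w.idxOf (m + 1) = cutPos (m + 1) y (y m) := by
  have hw := h.isPermWord
  have hp := hw.idxOf_lt
  have e := hw.getD_idxOf
  generalize w.idxOf (m + 1) = p at hp e
  have h1 := (h.key_lt_iff hp (y m)).not.1 (by rw [e]; exact lt_irrefl _)
  rcases Nat.eq_zero_or_pos p with rfl | hp0
  · omega
  · have h2 := (h.key_lt_iff (show p - 1 < m + 1 by omega) (y m)).1 (by
      have h3 := h.before (show p - 1 < p by omega) hp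
      have h4 := hw.le (show p - 1 < m + 1 by omega)
      rw [e, Nat.add_sub_cancel] at h3
      omega)
    omega

theorem b_eq (h : SortedBy n y w) (hy : IsModifiedAscent n y) : b w = y (n - 1) := by
  obtain ⟨m, rfl⟩ : ∃ m, n = m + 1 := ⟨n - 1, by have := hy.pos; omega⟩
  unfold b
  rw [h.isPermWord.length_eq, h.idxOf_eq, h.siteLabel_cutPos hy, Nat.add_sub_cancel]
  exact (le_peak y (Nat.lt_succ_self m)).trans (Nat.le_succ _)

end SortedBy

theorem sum_C_card_mul_X_pow {N : ℕ} (s : Finset ℕ) (key : ℕ → ℕ) (h : ∀ p ∈ s, key p < N) :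
    ∑ i ∈ Finset.range N, (C ({p ∈ s | key p = i}.card) * X ^ i : ℕ[X]) =
      ∑ p ∈ s, X ^ key p := by
  rw [← Finset.sum_fiberwise_of_maps_to (s := s) (t := Finset.range N) (g := key)
    fun p hp => Finset.mem_range.2 (h p hp)]
  refine Finset.sum_congr rfl fun i _ => ?_
  rw [Finset.sum_congr rfl fun p hp => by rw [(Finset.mem_filter.1 hp).2], Finset.sum_const,
    nsmul_eq_mul]
  simp

namespace SortedBy

variable {n : ℕ} {y : ℕ → ℕ} {w : List ℕ}

theorem key_lt_numActive (h : SortedBy n y w) (hy : IsModifiedAscent n y) {p : ℕ} (hp : p < n) :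
    y (w.getD p 0 - 1) < numActive w + 1 := by
  have h1 := h.le_numActive hy
  have h2 := h.isPermWord.le hp
  have h3 := h.isPermWord.one_le hp
  have := le_peak y (show w.getD p 0 - 1 < n by omega)
  omega

theorem delta_eq (h : SortedBy n y w) (hy : IsModifiedAscent n y) :
    delta w = ∑ j ∈ Finset.range n, (X : ℕ[X]) ^ y j := by
  classical
  rw [← h.isPermWord.sum_eq fun j => (X : ℕ[X]) ^ y j,
    ← sum_C_card_mul_X_pow (N := numActive w + 1) _ (fun p => y (w.getD p 0 - 1))
      fun p hp => h.key_lt_numActive hy (Finset.mem_range.1 hp)]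
  unfold delta
  refine Finset.sum_congr rfl fun i _ => ?_
  rw [h.isPermWord.length_eq]
  congr 3
  exact Finset.filter_congr fun p hp => h.entryBetween_iff hy (Finset.mem_range.1 hp)

theorem deltaBar_eq (h : SortedBy n y w) (hy : IsModifiedAscent n y) :
    deltaBar w =
      ∑ j ∈ Finset.range n with ∀ l < n, j < l → y l ≤ y j, (X : ℕ[X]) ^ y j := by
  classical
  have h1 : ∀ p ∈ rmaxPos w, p < n := fun p hp => by
    rw [h.rmaxPos_eq] at hp
    exact Finset.mem_range.1 (Finset.mem_filter.1 hp).1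
  rw [Finset.sum_filter, ← h.isPermWord.sum_eq
      fun j => if ∀ l < n, j < l → y l ≤ y j then (X : ℕ[X]) ^ y j else 0, ← Finset.sum_filter,
    ← h.rmaxPos_eq,
    ← sum_C_card_mul_X_pow (N := numActive w + 1) _ (fun p => y (w.getD p 0 - 1))
      fun p hp => h.key_lt_numActive hy (h1 p hp)]
  unfold deltaBar
  refine Finset.sum_congr rfl fun i _ => ?_
  congr 3
  exact Finset.filter_congr fun p hp => h.entryBetween_iff hy (h1 p hp)

/-- Block numbers are transported along the correspondence between positions p of `w` and indices
`w.getD p 0 - 1` of `y`. Letters in different blocks of a layered word increase with position, so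
the tie rule of the sorting never interferes. -/
theorem layered_iff (h : SortedBy n y w) (k : ℕ) :
    Layered k n (fun p => w.getD p 0) ↔ Layered k n y := by
  have hw := h.isPermWord
  constructor
  · rintro ⟨f, h1, h2, h3, h4⟩
    have hex : ∀ j, ∃ p, j < n → p < n ∧ w.getD p 0 = j + 1 := fun j => by
      by_cases hj : j < n
      · obtain ⟨p, hp, e⟩ := hw.exists_getD (show 1 ≤ j + 1 by omega) (by omega)
        exact ⟨p, fun _ => ⟨hp, e⟩⟩
      · exact ⟨0, fun h => absurd h hj⟩
    choose pos hpos using hex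
    have hmono : ∀ j < n, ∀ i ≤ j, f (pos i) ≤ f (pos j) := by
      intro j hj i hij
      obtain ⟨p1, p2⟩ := hpos i (by omega)
      obtain ⟨q1, q2⟩ := hpos j hj
      by_contra hc
      have := h4 _ q1 _ p1 (by omega)
      dsimp only at this
      omega
    refine ⟨fun j => f (pos j), fun j hj => h1 _ (hpos j hj).1, fun c hc => ?_, hmono, ?_⟩
    · obtain ⟨p, hp, e⟩ := h2 c hc
      have := hw.one_le hp
      have := hw.le hp
      have h5 := hpos (w.getD p 0 - 1) (by omega)
      refine ⟨w.getD p 0 - 1, by omega, ?_⟩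
      rw [← e]
      exact congrArg f ((hw.getD_inj h5.1 hp).1 (by omega))
    · intro i hi j hj hij
      dsimp only at hij
      obtain ⟨p1, p2⟩ := hpos i hi
      obtain ⟨q1, q2⟩ := hpos j hj
      have hlt : i < j := by
        by_contra hc
        have := hmono i hi j (by omega)
        omega
      have hlt' : pos i < pos j := by
        by_contra hc
        have := h3 _ p1 (pos j) (by omega)
        omega
      have := h.before hlt' q1
      rw [p2, q2, Nat.add_sub_cancel, Nat.add_sub_cancel] at this
      omega
  · rintro ⟨g, h1, h2, h3, h4⟩
    have hr : ∀ p < n, w.getD p 0 - 1 < n := fun p hp => by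
      have := hw.one_le hp
      have := hw.le hp
      omega
    refine ⟨fun p => g (w.getD p 0 - 1), fun p hp => h1 _ (hr p hp), fun c hc => ?_, ?_, ?_⟩
    · obtain ⟨j, hj, e⟩ := h2 c hc
      obtain ⟨p, hp, e'⟩ := hw.exists_getD (show 1 ≤ j + 1 by omega) (by omega)
      exact ⟨p, hp, by dsimp only; rw [e', Nat.add_sub_cancel, e]⟩
    · intro q hq p hpq
      dsimp only
      by_contra hc
      have h5 := h4 _ (hr q hq) _ (hr p (by omega)) (by omega)
      have h6 := h.key_mono hpq hq
      omega
    · intro p hp q hq hpq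
      dsimp only at hpq ⊢
      by_contra hc
      have := h3 _ (hr p hp) (w.getD q 0 - 1) (by omega)
      omega

end SortedBy

/-! ### The map from permutations to ascent sequences -/

/-- Erasing the largest letter leaves a sorted word, and bumping does not change the relative order
of the earlier keys. -/
theorem sortedBy_erase {n i : ℕ} {y y' : ℕ → ℕ} {w : List ℕ} (e : Extends n y y' i)
    (h : SortedBy (n + 1) y' w) : SortedBy n y (w.erase (n + 1)) := by
  have h1 : SortedBy n y' (w.erase (n + 1)) :=
    ⟨h.isPermWord.erase, h.pairwise.sublist List.erase_sublist⟩
  exact h1.congr fun i hi j hj => (e.lt_iff hi hj).symm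

theorem Extends.cutPos_eq {n i : ℕ} {y y' : ℕ → ℕ} (e : Extends n y y' i) :
    cutPos (n + 1) y' (y' n) = cutPos n y i := by
  unfold cutPos
  rw [e.1, Finset.range_add_one, Finset.filter_insert, if_neg (by rw [e.1]; exact lt_irrefl _)]
  congr 1
  exact Finset.filter_congr fun j hj => e.lt_letter_iff (Finset.mem_range.1 hj)

theorem lambdaAux_succ {n : ℕ} (hn : 0 < n) (w : List ℕ) :
    LambdaAux (n + 1) w =
      LambdaAux n (w.erase (n + 1)) ++ [siteLabel (w.erase (n + 1)) (w.idxOf (n + 1))] := by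
  obtain ⟨m, rfl⟩ : ∃ m, n = m + 1 := ⟨n - 1, by omega⟩
  rfl

/-- Induction on the last letter i. A word is determined by what remains after erasing its maximum
together with the place of the maximum, and on both sides that place is the boundary in front of
block i. -/
theorem IsAscentSeq.lambdaAux_iff {x : List ℕ} (hx : IsAscentSeq x) :
    ∀ w, IsPermWord x.length w →
      (Avoids w ∧ LambdaAux x.length w = x ↔ SortedBy x.length (modLetter x) w) := by
  induction hx using IsAscentSeq.induction with
  | single h =>
    intro w hw
    have : w = [1] := List.perm_singleton.1 hw
    subst this
    refine iff_of_true ⟨by decide, rfl⟩ ⟨hw, List.pairwise_singleton _ _⟩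
  | snoc z i hz hx hx' hi ih =>
    intro w hw
    have hpos := List.length_pos_iff.2 hz
    have e := hx'.extends_snoc hz
    have hy := hx.isModifiedAscent
    have hlen : (z ++ [i]).length = z.length + 1 := by simp
    rw [hlen] at hw ⊢
    have hile := e.letter_le hpos
    have hdecomp := hw.insertIdx_erase
    rw [lambdaAux_succ hpos]
    constructor
    · rintro ⟨h1, h2⟩
      obtain ⟨h3, h4⟩ := List.append_inj' h2 rfl
      have h4 : siteLabel (w.erase (z.length + 1)) (w.idxOf (z.length + 1)) = i := by
        simpa using h4
      have hple : w.idxOf (z.length + 1) ≤ z.length := Nat.lt_succ_iff.1 hw.idxOf_lt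
      have h5 : Avoids (w.erase (z.length + 1)) := by
        rw [← hdecomp, avoids_insertIdx_iff hw.erase hple] at h1
        exact h1.1
      have hs := (ih _ hw.erase).1 ⟨h5, h3⟩
      have hact : IsActive (w.erase (z.length + 1)) (w.idxOf (z.length + 1)) := by
        unfold IsActive
        rw [hw.erase.length_eq, hdecomp]
        exact ⟨hple, h1⟩
      obtain ⟨c, hc, hc'⟩ := (hs.isActive_iff hy).1 hact
      rw [← hc', hs.siteLabel_cutPos hy hc] at h4
      -- Compare `w` with the sorted word for the extended sequence: after erasing the maximum they
      -- agree by uniqueness of sorting, and both have the maximum at `cutPos z.length (modLetter z)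
      -- i`.
      obtain ⟨w', hw'⟩ := exists_sortedBy (z.length + 1) (modLetter (z ++ [i]))
      have hs' := sortedBy_erase e hw'
      have : w = w' := by
        rw [← hdecomp, ← hw'.isPermWord.insertIdx_erase, hs.unique hs', hw'.idxOf_eq,
          e.cutPos_eq, ← hc', h4]
      exact this ▸ hw'
    · intro h
      have hs := sortedBy_erase e h
      obtain ⟨-, h2⟩ := (ih _ hw.erase).2 hs
      refine ⟨h.avoids (hy.extend e), ?_⟩
      rw [h2, h.idxOf_eq, e.cutPos_eq, hs.siteLabel_cutPos hy hile]

/-! ### One-line notation -/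

theorem length_word {n : ℕ} (π : Equiv.Perm (Fin n)) : (word π).length = n := by
  simp [word]

theorem getD_word {n : ℕ} (π : Equiv.Perm (Fin n)) {i : ℕ} (hi : i < n) :
    (word π).getD i 0 = π ⟨i, hi⟩ + 1 := by
  rw [List.getD_eq_getElem _ _ (by rwa [length_word])]
  simp [word]

theorem word_injective {n : ℕ} : Function.Injective (word (n := n)) := by
  intro π σ h
  ext i
  have := congrArg (fun w => w.getD i 0) h
  simp only [getD_word _ i.2, Fin.eta] at this
  omega

theorem isPermWord_word {n : ℕ} (π : Equiv.Perm (Fin n)) : IsPermWord n (word π) := by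
  unfold IsPermWord
  refine (List.perm_ext_iff_of_nodup ?_ (List.nodup_range' ..)).2 fun a => ?_
  · unfold word
    rw [List.nodup_ofFn]
    intro i j hij
    exact π.injective (Fin.ext (by dsimp only at hij; omega))
  · unfold word
    rw [List.mem_ofFn, List.mem_range'_1]
    constructor
    · rintro ⟨i, rfl⟩
      have := (π i).2
      omega
    · intro h
      refine ⟨π.symm ⟨a - 1, by omega⟩, ?_⟩
      rw [Equiv.apply_symm_apply]
      dsimp only
      omega

theorem IsPermWord.exists_word_eq {n : ℕ} {w : List ℕ} (hw : IsPermWord n w) :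
    ∃ π : Equiv.Perm (Fin n), word π = w := by
  have hr : ∀ p < n, w.getD p 0 - 1 < n := fun p hp => by
    have := hw.one_le hp
    have := hw.le hp
    omega
  have hinj : Function.Injective fun p : Fin n => (⟨w.getD p 0 - 1, hr p p.2⟩ : Fin n) := by
    intro p q hpq
    have h1 := hw.one_le p.2
    have h2 := hw.one_le q.2
    have h3 := congrArg Fin.val hpq
    dsimp only at h3
    exact Fin.ext ((hw.getD_inj p.2 q.2).1 (by omega))
  refine ⟨Equiv.ofBijective _ (Finite.injective_iff_bijective.1 hinj), ?_⟩
  have hl := hw.length_eq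
  refine List.ext_getElem (by rw [length_word, hl]) fun p h1 h2 => ?_
  rw [← List.getD_eq_getElem _ 0 h1, ← List.getD_eq_getElem _ 0 h2, getD_word _ (by omega)]
  have := hw.one_le (show p < n by omega)
  simp only [Equiv.ofBijective_apply]
  omega

/-- An ascent of the inverse at j says that the letter j + 1 stands before j + 2; since ties are
decreasing, this forces a strict increase of the key. -/
theorem SortedBy.asc_inv {n : ℕ} {y : ℕ → ℕ} {π : Equiv.Perm (Fin n)}
    (h : SortedBy n y (word π)) :
    asc (word π⁻¹) = {j ∈ Finset.range (n - 1) | y j < y (j + 1)}.card := by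
  rw [asc_eq_card, length_word]
  congr 1
  refine Finset.filter_congr fun j hj => ?_
  rw [Finset.mem_range] at hj
  have hj0 : j < n := by omega
  have hj1 : j + 1 < n := by omega
  rw [getD_word _ hj0, getD_word _ hj1]
  have e : ∀ l (hl : l < n), (word π).getD (π⁻¹ ⟨l, hl⟩ : Fin n) 0 = l + 1 := fun l hl => by
    rw [getD_word _ (π⁻¹ ⟨l, hl⟩).2]
    simp
  have hb : ∀ l (hl : l < n) m (hm : m < n), (π⁻¹ ⟨l, hl⟩ : Fin n).1 < (π⁻¹ ⟨m, hm⟩ : Fin n).1 →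
      y l < y m ∨ y l = y m ∧ m < l := fun l hl m hm hlt => by
    have := h.before hlt (π⁻¹ ⟨m, hm⟩).2
    rw [e, e, Nat.add_sub_cancel, Nat.add_sub_cancel] at this
    omega
  constructor
  · intro hlt
    have := hb j hj0 (j + 1) hj1 (by omega)
    omega
  · intro hlt
    by_contra hc
    have hne : (π⁻¹ ⟨j + 1, hj1⟩ : Fin n).1 ≠ (π⁻¹ ⟨j, hj0⟩ : Fin n).1 := fun he => by
      have := e (j + 1) hj1
      rw [he, e] at this
      omega
    have := hb (j + 1) hj1 j hj0 (by omega)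
    omega

/-! ### Interval representations -/

/-- The relation `r` is represented by the intervals `[a v, b v]` of `{0, …, k}`: `r u v` holds
if and only if the interval of `u` is to the left of that of `v`; each of `0, …, k` is both a
left and a right endpoint. -/
structure IntervalRep {P : Type u} (r : P → P → Prop) (k : ℕ) (a b : P → ℕ) : Prop where
  lt_iff : ∀ u v, r u v ↔ b u < a v
  le : ∀ v, a v ≤ b v
  le_top : ∀ v, b v ≤ k
  surj_left : ∀ c ≤ k, ∃ v, a v = c
  surj_right : ∀ c ≤ k, ∃ v, b v = c

namespace IntervalRep

section

variable {P : Type u} [PartialOrder P] {k : ℕ} {a b : P → ℕ}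

theorem left_le_top (h : IntervalRep (P := P) (· < ·) k a b) (v : P) : a v ≤ k :=
  (h.le v).trans (h.le_top v)

theorem Iio_eq (h : IntervalRep (P := P) (· < ·) k a b) (v : P) :
    Set.Iio v = {u | b u < a v} := Set.ext fun u => h.lt_iff u v

theorem subset_iff (h : IntervalRep (P := P) (· < ·) k a b) {c d : ℕ} (hc : c ≤ k) :
    {u | b u < c} ⊆ {u | b u < d} ↔ c ≤ d := by
  refine ⟨fun hs => ?_, fun hcd u hu => lt_of_lt_of_le hu hcd⟩
  by_contra hlt
  obtain ⟨u, hu⟩ := h.surj_right d (by omega)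
  have : b u < d := hs (show b u < c by omega)
  omega

theorem ssubset_iff (h : IntervalRep (P := P) (· < ·) k a b) {c d : ℕ} (hc : c ≤ k) (hd : d ≤ k) :
    {u | b u < c} ⊂ {u | b u < d} ↔ c < d := by
  rw [ssubset_iff_subset_not_subset, h.subset_iff hc, h.subset_iff hd]
  omega

theorem injOn (h : IntervalRep (P := P) (· < ·) k a b) {m : ℕ} (hm : m ≤ k + 1) :
    Set.InjOn (fun c => {u | b u < c}) (Finset.range m : Set ℕ) := by
  intro c hc d hd hcd
  rw [Finset.mem_coe, Finset.mem_range] at hc hd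
  dsimp only at hcd
  exact le_antisymm ((h.subset_iff (by omega)).1 hcd.subset)
    ((h.subset_iff (by omega)).1 hcd.symm.subset)

theorem rank_eq (h : IntervalRep (P := P) (· < ·) k a b) : rank P = k := by
  have : Set.range (Set.Iio : P → Set P) =
      (fun c => {u | b u < c}) '' (Finset.range (k + 1) : Set ℕ) := by
    ext S
    simp only [Set.mem_range, Set.mem_image, Finset.mem_coe, Finset.mem_range]
    constructor
    · rintro ⟨v, rfl⟩
      exact ⟨a v, Nat.lt_succ_of_le (h.left_le_top v), (h.Iio_eq v).symm⟩
    · rintro ⟨c, hc, rfl⟩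
      obtain ⟨v, rfl⟩ := h.surj_left c (by omega)
      exact ⟨v, h.Iio_eq v⟩
  unfold rank
  rw [this, (h.injOn le_rfl).ncard_image, Set.ncard_coe_finset, Finset.card_range]
  rfl

/-- The predecessor sets are the sets of elements with right endpoint below c, for c ≤ k. Each
occurs since every c is a left endpoint, and they are distinct since every c is a right endpoint;
those properly inside `Set.Iio v` belong to c < a v. Hence the left endpoints are determined by the
order. -/
theorem level_eq (h : IntervalRep (P := P) (· < ·) k a b) (v : P) : level v = a v := by
  have hv := h.left_le_top v
  have : {S | S ∈ Set.range (Set.Iio : P → Set P) ∧ S ⊂ Set.Iio v} =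
      (fun c => {u | b u < c}) '' (Finset.range (a v) : Set ℕ) := by
    ext S
    simp only [Set.mem_range, Set.mem_image, Finset.mem_coe, Finset.mem_range, Set.mem_ofPred_eq]
    constructor
    · rintro ⟨⟨w, rfl⟩, hw⟩
      rw [h.Iio_eq, h.Iio_eq, h.ssubset_iff (h.left_le_top w) hv] at hw
      exact ⟨a w, hw, (h.Iio_eq w).symm⟩
    · rintro ⟨c, hc, rfl⟩
      obtain ⟨w, rfl⟩ := h.surj_left c (by omega)
      refine ⟨⟨w, h.Iio_eq w⟩, ?_⟩
      rwa [h.Iio_eq, h.ssubset_iff (h.left_le_top w) hv]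
  unfold level
  rw [this, (h.injOn (by omega)).ncard_image, Set.ncard_coe_finset,
    Finset.card_range]

theorem isMax_iff (h : IntervalRep (P := P) (· < ·) k a b) (v : P) : IsMax v ↔ b v = k := by
  rw [isMax_iff_forall_not_lt]
  constructor
  · intro hv
    obtain ⟨w, hw⟩ := h.surj_left k le_rfl
    have := (h.lt_iff v w).not.1 (hv w)
    have := h.le_top v
    omega
  · intro hv w hw
    have := (h.lt_iff v w).1 hw
    have := h.left_le_top w
    omega

theorem isMin_iff (h : IntervalRep (P := P) (· < ·) k a b) (v : P) : IsMin v ↔ a v = 0 := by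
  rw [isMin_iff_forall_not_lt]
  constructor
  · intro hv
    obtain ⟨w, hw⟩ := h.surj_right 0 (by omega)
    have := (h.lt_iff w v).not.1 (hv w)
    omega
  · intro hv w hw
    have := (h.lt_iff w v).1 hw
    omega

theorem predSet_eq (h : IntervalRep (P := P) (· < ·) k a b) {c : ℕ} (hc : c ≤ k) :
    predSet P c = {u | b u < c} := by
  ext u
  simp only [predSet, levelSet, Set.mem_ofPred_eq, h.level_eq]
  constructor
  · rintro ⟨v, rfl, hv⟩
    exact (h.lt_iff u v).1 hv
  · intro hu
    obtain ⟨v, rfl⟩ := h.surj_left c hc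
    exact ⟨v, rfl, (h.lt_iff u v).2 hu⟩

theorem twoTwoFree (h : IntervalRep (P := P) (· < ·) k a b) : TwoTwoFree P := by
  refine ⟨fun f => ?_⟩
  have h1 : f (Sum.inl 0) < f (Sum.inl 1) := f.lt_iff_lt.2 (by simp)
  have h2 : f (Sum.inr 0) < f (Sum.inr 1) := f.lt_iff_lt.2 (by simp)
  have h3 : ¬ f (Sum.inl 0) < f (Sum.inr 1) := f.lt_iff_lt.not.2 (by simp)
  have h4 : ¬ f (Sum.inr 0) < f (Sum.inl 1) := f.lt_iff_lt.not.2 (by simp)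
  rw [h.lt_iff] at h1 h2 h3 h4
  omega

theorem srank_eq_iff (h : IntervalRep (P := P) (· < ·) k a b) {v : P} (hv : b v = k) :
    a v = srank P ↔ ∀ u, b u = k → a v ≤ a u := by
  have hS : {i | ∃ v : P, IsMax v ∧ level v = i} = {i | ∃ v, b v = k ∧ a v = i} := by
    simp only [h.isMax_iff, h.level_eq]
  unfold srank
  rw [hS]
  constructor
  · intro e u hu
    rw [e]
    exact Nat.sInf_le (show ∃ v, b v = k ∧ a v = a u from ⟨u, hu, rfl⟩)
  · intro hle
    have hl : IsLeast {i | ∃ v, b v = k ∧ a v = i} (a v) :=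
      ⟨⟨v, hv, rfl⟩, by rintro i ⟨u, hu, rfl⟩; exact hle u hu⟩
    exact hl.csInf_eq.symm

end

end IntervalRep

theorem subset_or_subset_of_twoTwoFree {P : Type u} [PartialOrder P] (hP : TwoTwoFree P)
    (v w : P) : Set.Iio v ⊆ Set.Iio w ∨ Set.Iio w ⊆ Set.Iio v := by
  by_contra hc
  rw [not_or, Set.not_subset, Set.not_subset] at hc
  obtain ⟨⟨x, hxv, hxw⟩, y, hyw, hyv⟩ := hc
  rw [Set.mem_Iio] at hxv hxw hyw hyv
  have n1 : ¬ x ≤ y := fun h => hxw (h.trans_lt hyw)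
  have n2 : ¬ y ≤ x := fun h => hyv (h.trans_lt hxv)
  have n3 : ¬ v ≤ w := fun h => hxw (hxv.trans_le h)
  have n4 : ¬ w ≤ v := fun h => hyv (hyw.trans_le h)
  have n5 : ¬ x ≤ w := fun h => h.lt_or_eq.elim hxw fun h => n2 (h ▸ hyw.le)
  have n6 : ¬ y ≤ v := fun h => h.lt_or_eq.elim hyv fun h => n1 (h ▸ hxv.le)
  have n7 : ¬ v ≤ y := fun h => n1 (hxv.le.trans h)
  have n8 : ¬ w ≤ x := fun h => n2 (hyw.le.trans h)
  have n9 : ¬ v ≤ x := hxv.not_ge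
  have n10 : ¬ w ≤ y := hyw.not_ge
  refine hP.false (OrderEmbedding.ofMapLEIff (Sum.elim ![x, v] ![y, w]) ?_)
  rintro (i | i) (j | j) <;> fin_cases i <;> fin_cases j <;>
    simp [n1, n2, n3, n4, n5, n6, n7, n8, n9, n10, hxv.le, hyw.le]

/-- Predecessor sets form a chain D_0 ⊂ … ⊂ D_k. The left endpoint of v is the index of its
predecessor set, and its right endpoint is the index of the last set in the chain that does not
contain v. -/
theorem exists_intervalRep {P : Type u} [PartialOrder P] [Finite P] [Nonempty P]
    (hP : TwoTwoFree P) : ∃ k a b, IntervalRep (P := P) (· < ·) k a b := by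
  classical
  have := Fintype.ofFinite P
  let F : Finset (Set P) := Finset.univ.image Set.Iio
  have hF : ∀ v : P, Set.Iio v ∈ F := fun v => Finset.mem_image_of_mem _ (Finset.mem_univ v)
  have hF' : ∀ S ∈ F, ∃ v : P, Set.Iio v = S := fun S hS => by
    simpa [F] using hS
  have chain : ∀ S ∈ F, ∀ T ∈ F, S ⊆ T ∨ T ⊆ S := by
    intro S hS T hT
    obtain ⟨v, rfl⟩ := hF' S hS
    obtain ⟨w, rfl⟩ := hF' T hT
    exact subset_or_subset_of_twoTwoFree hP v w
  have hpos : 0 < F.card := Finset.card_pos.2 ⟨_, hF (Classical.arbitrary P)⟩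
  let pos : Set P → ℕ := fun S => {T ∈ F | T ⊂ S}.card
  have pos_lt : ∀ S ∈ F, ∀ T, S ⊂ T → pos S < pos T := by
    intro S hS T hST
    refine Finset.card_lt_card (Finset.ssubset_iff_of_subset ?_ |>.2 ⟨S, ?_, ?_⟩)
    · exact Finset.monotone_filter_right _ fun U _ hU => hU.trans hST
    · exact Finset.mem_filter.2 ⟨hS, hST⟩
    · simp
  have pos_lt_card : ∀ S ∈ F, pos S < F.card := by
    intro S hS
    refine Finset.card_lt_card (Finset.filter_ssubset.2 ⟨S, hS, ?_⟩)
    exact ssubset_irrefl S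
  have inj : Set.InjOn pos F := by
    intro S hS T hT e
    by_contra hne
    rcases chain S hS T hT with h | h
    · have := pos_lt S hS T (h.ssubset_of_ne hne)
      omega
    · have := pos_lt T hT S (h.ssubset_of_ne (Ne.symm hne))
      omega
  have surj : ∀ c < F.card, ∃ S ∈ F, pos S = c := by
    have : F.image pos = Finset.range F.card := by
      refine Finset.eq_of_subset_of_card_le ?_ ?_
      · intro c hc
        obtain ⟨S, hS, rfl⟩ := Finset.mem_image.1 hc
        exact Finset.mem_range.2 (pos_lt_card S hS)
      · rw [Finset.card_range, Finset.card_image_of_injOn inj]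
    intro c hc
    rw [← Finset.mem_range, ← this, Finset.mem_image] at hc
    exact hc
  -- The sets avoiding u form an initial segment of the chain, so this count is one more than the
  -- index of the last of them; it is positive because u is not below itself.
  let out : P → ℕ := fun u => {T ∈ F | u ∉ T}.card
  have lt_iff : ∀ u v : P, u < v ↔ out u ≤ pos (Set.Iio v) := by
    intro u v
    constructor
    · intro huv
      refine Finset.card_le_card (Finset.monotone_filter_right _ fun T hT hu => ?_)
      rcases chain T hT _ (hF v) with h | h
      · refine h.ssubset_of_ne ?_
        rintro rfl
        exact hu huv
      · exact absurd (h huv) hu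
    · intro hle
      by_contra hc
      have : {T ∈ F | T ⊂ Set.Iio v} ⊂ {T ∈ F | u ∉ T} := by
        refine Finset.ssubset_iff_of_subset ?_ |>.2 ⟨Set.Iio v, ?_, ?_⟩
        · exact Finset.monotone_filter_right _ fun T _ hT hu => hc (hT.subset hu)
        · exact Finset.mem_filter.2 ⟨hF v, hc⟩
        · simp
      have := Finset.card_lt_card this
      dsimp only [out, pos] at hle
      omega
  have out_pos : ∀ u, 1 ≤ out u := by
    intro u
    by_contra hc
    exact lt_irrefl _ ((lt_iff u u).2 (by omega))
  have out_le : ∀ u, out u ≤ F.card := fun u => Finset.card_filter_le _ _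
  refine ⟨F.card - 1, fun v => pos (Set.Iio v), fun v => out v - 1, ?_, ?_, ?_, ?_, ?_⟩
  · intro u v
    have := out_pos u
    have := lt_iff u v
    rw [this]
    omega
  · intro v
    have := (lt_iff v v).not.1 (lt_irrefl _)
    omega
  · intro v
    have := out_le v
    omega
  · intro c hc
    obtain ⟨S, hS, e⟩ := surj c (by omega)
    obtain ⟨v, rfl⟩ := hF' S hS
    exact ⟨v, e⟩
  · intro c hc
    -- For the top value take an element whose predecessor set is D_k: no predecessor set contains
    -- it. For smaller c take an element of D_{c+1} outside D_c.
    rcases hc.eq_or_lt with rfl | hc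
    · obtain ⟨S, hS, e⟩ := surj (F.card - 1) (by omega)
      obtain ⟨v, rfl⟩ := hF' S hS
      refine ⟨v, ?_⟩
      have := (lt_iff v v).not.1 (lt_irrefl _)
      have := out_le v
      omega
    · obtain ⟨S, hS, e⟩ := surj c (by omega)
      obtain ⟨T, hT, e'⟩ := surj (c + 1) (by omega)
      obtain ⟨v, rfl⟩ := hF' S hS
      obtain ⟨w, rfl⟩ := hF' T hT
      have hns : ¬ Set.Iio w ⊆ Set.Iio v := fun hs => by
        rcases hs.eq_or_ssubset with hs | hs
        · rw [hs] at e'; omega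
        · have := pos_lt _ hT _ hs
          omega
      obtain ⟨u, hu, hu'⟩ := Set.not_subset.1 hns
      have h1 := (lt_iff u w).1 hu
      have h2 := (lt_iff u v).not.1 hu'
      refine ⟨u, ?_⟩
      omega

/-! ### The removal operation -/

/-- Close the gap left by the letter `i`. -/
def unbump (i c : ℕ) : ℕ := if i < c then c - 1 else c

theorem unbump_bump (i c : ℕ) : unbump i (bump i c) = c := by
  unfold unbump bump; split_ifs <;> omega

theorem bump_unbump {i c : ℕ} (h : c ≠ i) : bump i (unbump i c) = c := by
  unfold unbump bump; split_ifs <;> omega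

theorem removeOrder_lt {P : Type u} [PartialOrder P] (v : P) (x y : {y : P // y ≠ v}) :
    (removeOrder v).lt x y ↔ x.1 < y.1 ∧ x.1 ∉ newMax P := Iff.rfl

/-- The endpoints `a', b'` and the top `k'` of the poset left after removing `v`, in terms of the
endpoints `a, b` and the top `k` of the given poset. -/
inductive IsRemoval {P : Type u} (v : P) (k : ℕ) (a b : P → ℕ) (k' : ℕ)
    (a' b' : {y : P // y ≠ v} → ℕ) : Prop
  | notAlone (u : P) (hu : u ≠ v) (hau : a u = a v) (hk : k' = k) (ha : ∀ u, a' u = a u)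
      (hb : ∀ u, b' u = b u)
  | top (hv : a v = k) (hk : k = k' + 1) (hlt : ∀ u, u ≠ v → a u < k) (ha : ∀ u, a' u = a u)
      (hb : ∀ u, b' u = b u)
  | alone (hv : a v < k) (hk : k = k' + 1) (hne : ∀ u, u ≠ v → a u ≠ a v)
      (ha : ∀ u, a' u = unbump (a v) (a u))
      (hb : ∀ u, b' u = if b u = a v then k' else unbump (a v) (b u))

/-- If v shares its level, all endpoints stay. If v is alone at the top level, it is the only
maximal element and the top drops by one. If v is alone at a lower level i, that level disappears:
endpoints above i drop by one, and the elements with right endpoint i become maximal. -/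
theorem IntervalRep.removal {P : Type u} [PartialOrder P] [Nontrivial P] {k : ℕ} {a b : P → ℕ}
    (h : IntervalRep (P := P) (· < ·) k a b) {v : P} (hv : b v = k) (hs : a v = srank P) :
    ∃ k' a' b', IntervalRep (removeOrder v).lt k' a' b' ∧ IsRemoval v k a b k' a' b' := by
  have hmin := (h.srank_eq_iff hv).1 hs
  have hle := h.le
  have htop := h.le_top
  have hlevel : levelSet P (srank P) = {u | a u = a v} := by
    simp only [levelSet, h.level_eq, hs]
  by_cases hal : ∃ u, u ≠ v ∧ a u = a v
  · obtain ⟨u₀, hu₀, hau₀⟩ := hal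
    have hN : newMax P = ∅ := by
      unfold newMax
      rw [if_neg]
      rintro ⟨h1, -⟩
      rw [hlevel, Set.ncard_eq_one] at h1
      obtain ⟨w, hw⟩ := h1
      have h2 : u₀ ∈ ({w} : Set P) := hw ▸ hau₀
      have h3 : v ∈ ({w} : Set P) := hw ▸ rfl
      exact hu₀ (h2.trans h3.symm)
    refine ⟨k, fun u => a u, fun u => b u, ⟨fun u w => ?_, fun u => hle u, fun u => htop u,
      fun c hc => ?_, fun c hc => ?_⟩, .notAlone u₀ hu₀ hau₀ rfl (fun _ => rfl) fun _ => rfl⟩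
    · rw [removeOrder_lt, hN, h.lt_iff]
      simp
    · obtain ⟨w, rfl⟩ := h.surj_left c hc
      by_cases hw : w = v
      · exact ⟨⟨u₀, hu₀⟩, hw ▸ hau₀⟩
      · exact ⟨⟨w, hw⟩, rfl⟩
    · rcases hc.eq_or_lt with rfl | hc
      -- The top must still be a right endpoint without v: any other element with left endpoint k
      -- will do, namely the companion `u₀` if v itself is at level k, and an element of the top
      -- level otherwise.
      · by_cases hv' : a v = c
        · refine ⟨⟨u₀, hu₀⟩, ?_⟩
          have := hle u₀
          have := htop u₀
          dsimp only
          omega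
        · obtain ⟨w, hw⟩ := h.surj_left c le_rfl
          refine ⟨⟨w, ?_⟩, ?_⟩
          · rintro rfl
            exact hv' hw
          · have := hle w
            have := htop w
            dsimp only
            omega
      · obtain ⟨w, rfl⟩ := h.surj_right c hc.le
        exact ⟨⟨w, by rintro rfl; omega⟩, rfl⟩
  · have hne : ∀ u, u ≠ v → a u ≠ a v := fun u hu e => hal ⟨u, hu, e⟩
    have hone : (levelSet P (srank P)).ncard = 1 := by
      rw [hlevel, Set.ncard_eq_one]
      refine ⟨v, Set.eq_singleton_iff_unique_mem.2 ⟨rfl, fun u hu => ?_⟩⟩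
      by_contra hc
      exact hne u hc hu
    rcases (h.left_le_top v).eq_or_lt with hvk | hvk
    · have hN : newMax P = ∅ := by
        unfold newMax
        rw [if_neg]
        rintro ⟨-, h1⟩
        rw [h.rank_eq] at h1
        omega
      have hlt : ∀ u, u ≠ v → b u < k := fun u hu => by
        have h1 := htop u
        have h2 := hne u hu
        have h3 := h.left_le_top u
        by_contra hc
        have := hmin u (by omega)
        omega
      have hk : 1 ≤ k := by
        obtain ⟨u, hu⟩ := exists_ne v
        have := hlt u hu
        omega
      refine ⟨k - 1, fun u => a u, fun u => b u, ⟨fun u w => ?_, fun u => hle u, fun u => ?_,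
        fun c hc => ?_, fun c hc => ?_⟩,
        .top hvk (by omega) (fun u hu => (hle u).trans_lt (hlt u hu)) (fun _ => rfl)
          fun _ => rfl⟩
      · rw [removeOrder_lt, hN, h.lt_iff]
        simp
      · have := hlt u u.2
        omega
      · obtain ⟨w, rfl⟩ := h.surj_left c (by omega)
        exact ⟨⟨w, by rintro rfl; omega⟩, rfl⟩
      · obtain ⟨w, rfl⟩ := h.surj_right c (by omega)
        exact ⟨⟨w, by rintro rfl; omega⟩, rfl⟩
    -- D_{i+1} \ D_i consists of the elements whose right endpoint is exactly i.
    · have hN : ∀ u, u ∈ newMax P ↔ b u = a v := by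
        intro u
        unfold newMax
        rw [if_pos ⟨hone, by rw [h.rank_eq]; omega⟩, ← hs, h.predSet_eq hvk,
          h.predSet_eq hvk.le, Set.mem_sdiff, Set.mem_ofPred_eq, Set.mem_ofPred_eq]
        omega
      refine ⟨k - 1, fun u => unbump (a v) (a u),
        fun u => if b u = a v then k - 1 else unbump (a v) (b u),
        ⟨fun u w => ?_, fun u => ?_, fun u => ?_, fun c hc => ?_, fun c hc => ?_⟩,
        .alone hvk (by omega) hne (fun _ => rfl) fun _ => rfl⟩
      · rw [removeOrder_lt, hN, h.lt_iff]
        have h1 := hne w w.2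
        have h2 := h.left_le_top w
        unfold unbump
        split_ifs <;> omega
      · have h1 := hne u u.2
        have h2 := hle u
        have h3 := htop u
        unfold unbump
        split_ifs <;> omega
      · have h3 := htop u
        unfold unbump
        split_ifs <;> omega
      · by_cases hcv : c < a v
        · obtain ⟨w, hw⟩ := h.surj_left c (by omega)
          refine ⟨⟨w, by rintro rfl; omega⟩, ?_⟩
          unfold unbump
          dsimp only
          split_ifs <;> omega
        · obtain ⟨w, hw⟩ := h.surj_left (c + 1) (by omega)
          refine ⟨⟨w, by rintro rfl; omega⟩, ?_⟩
          unfold unbump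
          dsimp only
          split_ifs <;> omega
      · by_cases hcv : c < a v
        · obtain ⟨w, hw⟩ := h.surj_right c (by omega)
          refine ⟨⟨w, by rintro rfl; omega⟩, ?_⟩
          unfold unbump
          dsimp only
          split_ifs <;> omega
        -- The new top is attained by the elements that have just become maximal; their old right
        -- endpoint was `a v`.
        · by_cases hck : c + 1 = k
          · obtain ⟨w, hw⟩ := h.surj_right (a v) (by omega)
            refine ⟨⟨w, by rintro rfl; omega⟩, ?_⟩
            dsimp only
            split_ifs
            omega
          · obtain ⟨w, hw⟩ := h.surj_right (c + 1) (by omega)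
            refine ⟨⟨w, by rintro rfl; omega⟩, ?_⟩
            unfold unbump
            dsimp only
            split_ifs <;> omega

/-! ### Posets built from modified ascent sequences -/

/-- Up to a relabelling of the elements, the intervals `[a v, b v]` are those of the sequence
`y`. -/
def Matches {P : Type u} (n : ℕ) (y : ℕ → ℕ) (a b : P → ℕ) (e : P ≃ Fin n) : Prop :=
  ∀ v, a v = y (e v) ∧ b v = reach n y (e v)

namespace Matches

variable {P : Type u} {n k : ℕ} {y : ℕ → ℕ} {a b : P → ℕ} {e : P ≃ Fin n}

theorem left_symm (m : Matches n y a b e) (j : Fin n) : a (e.symm j) = y j := by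
  rw [(m _).1, Equiv.apply_symm_apply]

theorem right_symm (m : Matches n y a b e) (j : Fin n) : b (e.symm j) = reach n y j := by
  rw [(m _).2, Equiv.apply_symm_apply]

theorem peak_eq {r : P → P → Prop} (m : Matches n y a b e) (h : IntervalRep r k a b) :
    peak n y = k := by
  refine Fishburn.peak_eq (fun j hj => ?_) ?_
  · rw [← m.left_symm ⟨j, hj⟩]
    exact (h.le _).trans (h.le_top _)
  · obtain ⟨v, hv⟩ := h.surj_left k le_rfl
    exact ⟨e v, (e v).2, by rw [← (m v).1, hv]⟩

theorem right_eq_iff {r : P → P → Prop} (m : Matches n y a b e) (h : IntervalRep r k a b)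
    (hy : IsModifiedAscent n y) (v : P) :
    b v = k ↔ ∀ t < n, (e v : ℕ) < t → y t ≤ y (e v) := by
  rw [(m v).2, ← m.peak_eq h, reach_eq_peak_iff hy]

theorem srank_eq [PartialOrder P] (m : Matches n y a b e)
    (h : IntervalRep (P := P) (· < ·) k a b) (hy : IsModifiedAscent n y) :
    srank P = y (n - 1) := by
  have hn : n - 1 < n := by have := hy.pos; omega
  have h1 : b (e.symm ⟨n - 1, hn⟩) = k := by
    rw [m.right_symm, ← m.peak_eq h]
    exact reach_of_rmax fun t h1 h2 => by dsimp only at h2; omega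
  have h2 := m.left_symm ⟨n - 1, hn⟩
  rw [← (h.srank_eq_iff h1).2, h2]
  intro u hu
  rw [h2, (m u).1]
  rw [m.right_eq_iff h hy] at hu
  rcases eq_or_lt_of_le (Nat.le_sub_one_of_lt (e u).2) with he | he
  · rw [he]
  · exact hu _ hn he

end Matches

theorem exists_equiv_restrict {P : Type u} {n : ℕ} (e : P ≃ Fin (n + 1)) {v : P}
    (hv : e v = Fin.last n) :
    ∃ e₀ : {u : P // u ≠ v} ≃ Fin n, ∀ u, (e₀ u : ℕ) = e u := by
  refine ⟨(e.subtypeEquiv (q := fun j => j ≠ Fin.last n) fun u => ?_).trans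
    (finSuccAboveEquiv (Fin.last n)).symm, fun u => ?_⟩
  · rw [← hv, Ne, Ne, e.apply_eq_iff_eq]
  · obtain ⟨j, hj⟩ := (finSuccAboveEquiv (Fin.last n)).surjective
      (e.subtypeEquiv (q := fun j => j ≠ Fin.last n)
        (fun u => by rw [← hv, Ne, Ne, e.apply_eq_iff_eq]) u)
    have h1 := congrArg (fun t => (t.1 : ℕ)) hj
    simp only [finSuccAboveEquiv_apply, Fin.succAbove_last, Equiv.subtypeEquiv_apply,
      Fin.val_castSucc] at h1
    rw [← h1]
    simp only [Equiv.trans_apply]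
    rw [← hj]
    simp

theorem exists_equiv_extend {P : Type u} {n : ℕ} {v : P} (e₀ : {u : P // u ≠ v} ≃ Fin n) :
    ∃ e : P ≃ Fin (n + 1), e v = Fin.last n ∧ ∀ u : {u : P // u ≠ v}, (e u : ℕ) = e₀ u := by
  classical
  refine ⟨(Equiv.optionSubtypeNe v).symm.trans ((Equiv.optionCongr e₀).trans
    finSuccEquivLast.symm), ?_, fun u => ?_⟩
  · simp
  · have : (Equiv.optionSubtypeNe v).symm u = some u := by
      rw [Equiv.symm_apply_eq]; simp
    simp [this]

/-- The shape of the removal is forced by the shape of the extension: if i creates an ascent,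
bumping has left v alone at level i; otherwise i occurred before, so v has a companion there. In
each case the endpoint formulas are inverse to one another. -/
theorem IsRemoval.matches_removed {P : Type u} [PartialOrder P] {n i k k' : ℕ} {y y' : ℕ → ℕ}
    {a b : P → ℕ} {e : P ≃ Fin (n + 1)} {v : P} {a' b' : {u : P // u ≠ v} → ℕ}
    (hrem : IsRemoval v k a b k' a' b')
    (h : IntervalRep (P := P) (· < ·) k a b) (m : Matches (n + 1) y' a b e)
    (hy : IsModifiedAscent n y) (ex : Extends n y y' i) (hv : b v = k) (hs : a v = srank P) :
    ∃ e₀, Matches n y a' b' e₀ := by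
  have hy' := hy.extend ex
  have hpk := m.peak_eq h
  have hvi : a v = i := by rw [hs, m.srank_eq h hy', Nat.add_sub_cancel, ex.1]
  -- The removed element and the element at the last position have the same interval [i, k], so
  -- interchanging their positions preserves the match.
  obtain ⟨e, m, hev⟩ : ∃ e : P ≃ Fin (n + 1), Matches (n + 1) y' a b e ∧ e v = Fin.last n := by
    refine ⟨e.trans (Equiv.swap (e v) (Fin.last n)), fun u => ?_, by simp⟩
    rw [Equiv.trans_apply]
    by_cases h1 : e u = e v
    · obtain rfl := e.injective h1
      rw [Equiv.swap_apply_left, Fin.val_last, Extends.reach_last, hvi, ex.1, hv, hpk]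
      exact ⟨rfl, rfl⟩
    by_cases h2 : e u = Fin.last n
    · rw [h2, Equiv.swap_apply_right, ← (m v).1, ← (m v).2, hvi, hv, (m u).1, (m u).2, h2,
        Fin.val_last, Extends.reach_last, ex.1, hpk]
      exact ⟨rfl, rfl⟩
    · rw [Equiv.swap_apply_of_ne_of_ne h1 h2]
      exact m u
  obtain ⟨e₀, he₀⟩ := exists_equiv_restrict e hev
  refine ⟨e₀, fun u => ?_⟩
  have hu := m u
  rw [← he₀] at hu
  obtain ⟨hua, hub⟩ := hu
  have hj := (e₀ u).2
  have hru := reach_le_peak n y (e₀ u)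
  have hyu := le_peak y hj
  rcases lt_or_ge (y (n - 1)) i with hi | hi
  · obtain ⟨hip, hbump⟩ : i ≤ peak n y + 1 ∧ ∀ j < n, y' j = bump i (y j) := by
      rcases ex.2 with ⟨-, h⟩ | ⟨h, -⟩
      · exact h
      · omega
    rw [ex.peak_of_lt hy.pos hi] at hpk
    rw [ex.reach_of_lt hy hi hj] at hub
    rw [hbump _ hj] at hua
    cases hrem with
    | notAlone w hw haw hk ha hb =>
      have h1 := he₀ ⟨w, hw⟩
      have h2 := (m w).1
      dsimp only at h1
      rw [← h1, hbump _ (e₀ ⟨w, hw⟩).2] at h2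
      -- A companion of v would carry the letter i, the one value that bumping leaves vacant.
      exact absurd (by omega) (bump_ne i (y (e₀ ⟨w, hw⟩)))
    | top hvk hk hlt ha hb =>
      rw [ha, hb, hua, hub, bump_of_lt (by omega), if_pos (show y (e₀ u) < i by omega)]
      refine ⟨rfl, ?_⟩
      split_ifs with hr
      · exact bump_of_lt (by omega)
      · omega
    | alone hvk hk hne ha hb =>
      rw [ha, hb, hua, hub, hvi, unbump_bump]
      refine ⟨rfl, ?_⟩
      split_ifs with h1 h2 h2 h3 h3
      · exact absurd h2 (bump_ne _ _)
      · exact unbump_bump _ _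
      · omega
      · omega
      · omega
      · unfold unbump
        split_ifs <;> omega
  · have hsame : ∀ j < n, y' j = y j := by
      rcases ex.2 with ⟨h, -⟩ | ⟨-, h⟩
      · omega
      · exact h
    rw [ex.reach_of_le hi hj] at hub
    rw [hsame _ hj] at hua
    obtain ⟨l, hl, hli⟩ := hy.surj (n - 1) (by have := hy.pos; omega) i hi
    have hal : a (e₀.symm ⟨l, hl⟩) = a v := by
      rw [(m _).1, ← he₀, Equiv.apply_symm_apply, hsame l hl, hli, hvi]
    cases hrem with
    | notAlone w hw haw hk ha hb =>
      rw [ha, hb, hua, hub]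
      exact ⟨rfl, rfl⟩
    | top hvk hk hlt ha hb =>
      have := hlt _ (e₀.symm ⟨l, hl⟩).2
      omega
    | alone hvk hk hne ha hb =>
      exact absurd hal (hne _ (e₀.symm ⟨l, hl⟩).2)

/-- The shape of the removal decides how `a v` compares with `y (n - 1)`, hence which branch of
`Extends` applies. After that the endpoint formulas are inverted. -/
theorem IsRemoval.matches_of_removed {P : Type u} [PartialOrder P] {n k k' : ℕ} {y y' : ℕ → ℕ}
    {a b : P → ℕ} {v : P} {a' b' : {u : P // u ≠ v} → ℕ} {e₀ : {u : P // u ≠ v} ≃ Fin n}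
    (hrem : IsRemoval v k a b k' a' b')
    (h : IntervalRep (P := P) (· < ·) k a b) (h' : IntervalRep (removeOrder v).lt k' a' b')
    (m : Matches n y a' b' e₀) (hy : IsModifiedAscent n y) (ex : Extends n y y' (a v))
    (hv : b v = k) (hs : a v = srank P) :
    ∃ e, Matches (n + 1) y' a b e := by
  obtain ⟨e, hev, he⟩ := exists_equiv_extend e₀
  have hpk := m.peak_eq h'
  have hmin := (h.srank_eq_iff hv).1 hs
  have hn : n - 1 < n := by have := hy.pos; omega
  suffices hkey : peak (n + 1) y' = k ∧ ∀ u : {u : P // u ≠ v},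
      a u = y' (e₀ u) ∧ b u = reach (n + 1) y' (e₀ u) by
    refine ⟨e, fun u => ?_⟩
    by_cases huv : u = v
    · subst huv
      rw [hev, Fin.val_last, Extends.reach_last, ex.1, hkey.1]
      exact ⟨rfl, hv⟩
    · have := hkey.2 ⟨u, huv⟩
      rwa [← he] at this
  have hbumps : y (n - 1) < a v → ∀ j < n, y' j = bump (a v) (y j) := by
    intro hi
    rcases ex.2 with ⟨-, -, h⟩ | ⟨h, -⟩
    · exact h
    · omega
  cases hrem with
  | notAlone w hw haw hk ha hb =>
    -- The element at the last position is maximal, also in P since right endpoints are unchanged,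
    -- so minimality of the level of v gives `a v ≤ y (n - 1)`.
    have h1 : b' (e₀.symm ⟨n - 1, hn⟩) = k' := by
      rw [m.right_symm, ← hpk]
      exact reach_of_rmax fun t h1 h2 => by dsimp only at h2; omega
    have h2 := m.left_symm ⟨n - 1, hn⟩
    rw [ha] at h2
    rw [hb] at h1
    have hi : a v ≤ y (n - 1) := by
      rw [← h2]
      exact hmin _ (by omega)
    have hsame : ∀ j < n, y' j = y j := by
      rcases ex.2 with ⟨h, -⟩ | ⟨-, h⟩
      · omega
      · exact h
    refine ⟨by rw [ex.peak_of_le hy.pos hi]; omega, fun u => ?_⟩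
    rw [ex.reach_of_le hi (e₀ u).2, hsame _ (e₀ u).2, ← (m u).1, ← (m u).2, ha, hb]
    exact ⟨rfl, rfl⟩
  | top hvk hk hlt ha hb =>
    have hi : y (n - 1) < a v := by
      have := le_peak y hn
      omega
    refine ⟨by rw [ex.peak_of_lt hy.pos hi]; omega, fun u => ?_⟩
    have hj := (e₀ u).2
    have hru := reach_le_peak n y (e₀ u)
    have hyu := le_peak y hj
    rw [ex.reach_of_lt hy hi hj, hbumps hi _ hj, ← ha, ← hb, (m u).1, (m u).2,
      bump_of_lt (by omega), if_pos (show y (e₀ u) < a v by omega)]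
    refine ⟨rfl, ?_⟩
    split_ifs with hr
    · exact (bump_of_lt (by omega)).symm
    · omega
  | alone hvk hk hne ha hb =>
    have hi : y (n - 1) < a v := by
      -- An element with right endpoint `a v` becomes maximal, so its position is a right-to-left
      -- maximum and its letter is at least the last one. Its left endpoint is below `a v`, because
      -- v is alone at its level.
      obtain ⟨u, hu⟩ := h.surj_right (a v) hvk.le
      have huv : u ≠ v := by rintro rfl; omega
      have h1 := hb ⟨u, huv⟩
      rw [if_pos hu, m.right_eq_iff h' hy] at h1
      have h2 := h.le u
      have h3 := hne u huv
      have h4 := (m ⟨u, huv⟩).1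
      have h5 := ha ⟨u, huv⟩
      unfold unbump at h5
      dsimp only at h5
      rw [if_neg (by omega)] at h5
      rcases eq_or_lt_of_le (Nat.le_sub_one_of_lt (e₀ ⟨u, huv⟩).2) with he | he
      · rw [he] at h4; omega
      · have := h1 _ hn he
        omega
    refine ⟨by rw [ex.peak_of_lt hy.pos hi]; omega, fun u => ?_⟩
    have hj := (e₀ u).2
    have h1 := h.le u
    have h2 := hne u u.2
    have h3 := h.le_top u
    have h4 := hmin u
    have h5 := ha u
    have h6 := hb u
    rw [ex.reach_of_lt hy hi hj, hbumps hi _ hj, ← (m u).1, ← (m u).2, hpk, h5, h6,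
      bump_unbump h2]
    refine ⟨rfl, ?_⟩
    unfold bump unbump
    split_ifs <;> omega

theorem removeOrder_nat_card {P : Type u} [Finite P] {n : ℕ} (v : P) (hc : Nat.card P = n + 1) :
    Nat.card {u : P // u ≠ v} = n := by
  have h1 : Nat.card {u : P // u ≠ v} = ({v}ᶜ : Set P).ncard := rfl
  have h2 := Set.ncard_add_ncard_compl ({v} : Set P)
  rw [Set.ncard_singleton] at h2
  omega

/-- All that is used about the chosen element is that it is maximal and of minimal level; in terms
of endpoints this fixes its interval. -/
theorem PsiAux_succ {n : ℕ} (hn : 0 < n) (P : Type u) [PartialOrder P] {k : ℕ} {a b : P → ℕ}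
    (h : IntervalRep (P := P) (· < ·) k a b) :
    ∃ v : P, b v = k ∧ a v = srank P ∧
      PsiAux (n + 1) P inferInstance =
        PsiAux n {u : P // u ≠ v} (removeOrder v) ++ [srank P] := by
  obtain ⟨m, rfl⟩ : ∃ m, n = m + 1 := ⟨n - 1, by omega⟩
  have hex : ∃ v : P, IsMax v ∧ level v = srank P := by
    obtain ⟨w, hw⟩ := h.surj_right k le_rfl
    exact Nat.sInf_mem (s := {i | ∃ v : P, IsMax v ∧ level v = i})
      ⟨_, w, (h.isMax_iff w).2 hw, rfl⟩
  refine ⟨hex.choose, (h.isMax_iff _).1 hex.choose_spec.1,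
    (h.level_eq _).symm.trans hex.choose_spec.2, ?_⟩
  rw [PsiAux, dif_pos hex]

/-- Induction on the last letter, quantified over all posets and all their representations because
the removed poset has another carrier. `IsRemoval.matches_removed` and
`IsRemoval.matches_of_removed` give the two directions. -/
theorem IsAscentSeq.psiAux_iff {x : List ℕ} (hx : IsAscentSeq x) :
    ∀ (P : Type u) [o : PartialOrder P] [Finite P] (k : ℕ) (a b : P → ℕ),
      Nat.card P = x.length → IntervalRep (P := P) (· < ·) k a b →
      (PsiAux x.length P o = x ↔ ∃ e, Matches x.length (modLetter x) a b e) := by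
  induction hx using IsAscentSeq.induction with
  | single h0 =>
    intro P _ _ k a b hc h
    refine iff_of_true rfl ?_
    have hc1 : Nat.card P = 1 := hc
    have hsub : Subsingleton P := (Nat.card_eq_one_iff_unique.1 hc1).1
    obtain ⟨v, hv⟩ := h.surj_left 0 (by omega)
    obtain ⟨w, hw⟩ := h.surj_left k le_rfl
    have hk : k = 0 := by rw [← hw, ← hv, Subsingleton.elim w v]
    refine ⟨Finite.equivFinOfCardEq hc1, fun u => ?_⟩
    have h1 := h.le u
    have h2 := h.le_top u
    have h3 : ((Finite.equivFinOfCardEq hc1 u : Fin 1) : ℕ) = 0 := by omega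
    have h4 : modLetter [0] 0 = 0 := rfl
    have h5 := reach_le_peak 1 (modLetter [0]) 0
    have h6 : peak 1 (modLetter [0]) = 0 := rfl
    have h7 : a u = 0 ∧ b u = 0 := by omega
    rw [h3]
    exact ⟨h7.1.trans h4.symm, h7.2.trans (Nat.le_zero.1 h5).symm⟩
  | snoc z i hz hx hx' hi ih =>
    intro P o _ k a b hc h
    have hpos := List.length_pos_iff.2 hz
    have ex := hx'.extends_snoc hz
    have hy := hx.isModifiedAscent
    have hlen : (z ++ [i]).length = z.length + 1 := by simp
    rw [hlen] at hc ⊢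
    have : Nontrivial P := Finite.one_lt_card_iff_nontrivial.1 (by omega)
    obtain ⟨v, hv, hs, hpsi⟩ := PsiAux_succ hpos P h
    obtain ⟨k', a', b', h', hrem⟩ := h.removal hv hs
    have hih := @ih {u : P // u ≠ v} (removeOrder v) _ k' a' b' (removeOrder_nat_card v hc) h'
    constructor
    · intro heq
      obtain ⟨h1, h2⟩ := List.append_inj' (hpsi.symm.trans heq) rfl
      obtain ⟨e₀, m⟩ := hih.1 h1
      have h3 : a v = i := by rw [hs]; simpa using h2
      exact hrem.matches_of_removed h h' m hy (h3 ▸ ex) hv hs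
    · rintro ⟨e, m⟩
      refine hpsi.trans ?_
      rw [hih.2 (hrem.matches_removed h m hy ex hv hs), m.srank_eq h (hy.extend ex),
        Nat.add_sub_cancel, ex.1]

/-- The interval order of a modified ascent sequence. -/
@[reducible]
noncomputable def intervalOrder (n : ℕ) (y : ℕ → ℕ) : PartialOrder (Fin n) where
  le i j := i = j ∨ reach n y i < y j
  lt i j := reach n y i < y j
  lt_iff_le_not_ge i j := by
    have h1 := le_reach y i.2
    have h2 := le_reach y j.2
    constructor
    · intro h
      refine ⟨Or.inr h, ?_⟩
      rintro (rfl | h') <;> omega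
    · rintro ⟨rfl | h, h'⟩
      · exact absurd (Or.inl rfl) h'
      · exact h
  le_refl _ := Or.inl rfl
  le_trans i j l hij hjl := by
    have h2 := le_reach y j.2
    rcases hij with rfl | hij
    · exact hjl
    · rcases hjl with rfl | hjl
      · exact Or.inr hij
      · exact Or.inr (by omega)
  le_antisymm i j hij hji := by
    have h1 := le_reach y i.2
    have h2 := le_reach y j.2
    rcases hij with h | hij
    · exact h
    · rcases hji with h | hji
      · exact h.symm
      · omega

theorem intervalRep_intervalOrder {n : ℕ} {y : ℕ → ℕ} (hy : IsModifiedAscent n y) :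
    IntervalRep (intervalOrder n y).lt (peak n y) (fun j => y j) fun j => reach n y j where
  lt_iff _ _ := Iff.rfl
  le j := le_reach y j.2
  le_top j := reach_le_peak n y j
  surj_left c hc := by
    obtain ⟨l, hl, e⟩ := hy.exists_eq hc
    exact ⟨⟨l, hl⟩, e⟩
  surj_right c hc := by
    obtain ⟨l, hl, e⟩ := exists_reach_eq hy hc
    exact ⟨⟨l, hl⟩, e⟩

/-- Reduces to `psiAux_iff` once P is known to have as many elements as x has letters. -/
theorem IsAscentSeq.exists_intervalRep_matches {x : List ℕ} (hx : IsAscentSeq x) (P : Type u)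
    [PartialOrder P] [Finite P] (hP : TwoTwoFree P) (hpsi : Psi P = x) :
    ∃ k a b e, IntervalRep (P := P) (· < ·) k a b ∧ Matches x.length (modLetter x) a b e := by
  have hne : Nonempty P := by
    by_contra hemp
    rw [not_nonempty_iff] at hemp
    unfold Psi at hpsi
    rw [Nat.card_of_isEmpty, PsiAux] at hpsi
    have := hx.isModifiedAscent.pos
    rw [← hpsi] at this
    simp at this
  obtain ⟨k, a, b, h⟩ := exists_intervalRep hP
  -- The recursion never reaches its default value `[]`: a maximal element of minimal level always
  -- exists, and the poset left after removal is again (2+2)-free.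
  have hlen : ∀ (m : ℕ) (Q : Type u) (o : PartialOrder Q), Finite Q → TwoTwoFree Q →
      Nat.card Q = m + 1 → (PsiAux (m + 1) Q o).length = m + 1 := by
    intro m
    induction m with
    | zero => intros; rfl
    | succ m ih =>
      intro Q o _ hQ hc
      have : Nontrivial Q := Finite.one_lt_card_iff_nontrivial.1 (by omega)
      obtain ⟨k, a, b, h⟩ := exists_intervalRep hQ
      obtain ⟨v, hv, hs, e⟩ := PsiAux_succ (Nat.succ_pos m) Q h
      obtain ⟨k', a', b', h', -⟩ := h.removal hv hs
      have h1 := ih {u : Q // u ≠ v} (removeOrder v) inferInstance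
        (@IntervalRep.twoTwoFree _ (removeOrder v) _ _ _ h') (removeOrder_nat_card v hc)
      rw [e, List.length_append, h1]
      rfl
  have hcard : Nat.card P = x.length := by
    have hpos : 0 < Nat.card P := Nat.card_pos
    have := hlen (Nat.card P - 1) P inferInstance inferInstance hP (by omega)
    rw [show Nat.card P - 1 + 1 = Nat.card P by omega] at this
    rw [← this, ← hpsi]
    rfl
  unfold Psi at hpsi
  rw [hcard] at hpsi
  obtain ⟨e, m⟩ := (hx.psiAux_iff P k a b hcard h).1 hpsi
  exact ⟨k, a, b, e, h, m⟩

/-! ### Statistics of posets -/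

/-- The summands are the fibres of the map; pairs in different fibres must be comparable in the
order of the indices. -/
theorem isOrdinalSum_iff (P : Type u) [PartialOrder P] (k : ℕ) :
    IsOrdinalSum P k ↔
      ∃ f : P → Fin k, Function.Surjective f ∧ ∀ v w, f v < f w → v < w := by
  constructor
  · rintro ⟨Q, _, hQ, ⟨e⟩⟩
    refine ⟨fun v => (ofLex (e v)).1, fun c => ?_, fun v w hvw => ?_⟩
    · obtain ⟨q⟩ := hQ c
      exact ⟨e.symm (toLex ⟨c, q⟩), by simp⟩
    · rw [← e.lt_iff_lt, Sigma.Lex.lt_def]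
      exact Or.inl hvw
  · rintro ⟨f, hf, hlt⟩
    refine ⟨fun c => {v : P // f v = c}, fun _ => inferInstance, fun c => ?_, ⟨?_⟩⟩
    · obtain ⟨v, hv⟩ := hf c
      exact ⟨⟨v, hv⟩⟩
    · refine ⟨(Equiv.sigmaFiberEquiv f).symm.trans toLex, fun {v w} => ?_⟩
      rw [Sigma.Lex.le_def]
      constructor
      · rintro (h | ⟨h, h'⟩)
        · exact (hlt v w h).le
        -- Two elements of one fibre are compared across an equality of indices; generalising both
        -- indices lets the transport vanish.
        · have key : ∀ (c d : Fin k) (hcd : c = d) (p : {v : P // f v = c})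
              (q : {v : P // f v = d}), hcd ▸ p ≤ q → p.1 ≤ q.1 := by
            rintro c _ rfl p q hpq
            exact hpq
          exact key _ _ h _ _ h'
      · intro hvw
        rcases lt_trichotomy (f v) (f w) with h | h | h
        · exact Or.inl h
        · refine Or.inr ⟨h, ?_⟩
          have key : ∀ (c d : Fin k) (hcd : c = d) (p : {v : P // f v = c})
              (q : {v : P // f v = d}), p.1 ≤ q.1 → hcd ▸ p ≤ q := by
            rintro c _ rfl p q hpq
            exact hpq
          exact key _ _ h ⟨v, rfl⟩ ⟨w, rfl⟩ hvw
        · exact absurd (hlt w v h) (not_lt_of_ge hvw)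

namespace Matches

variable {P : Type u} [PartialOrder P] {n k : ℕ} {y : ℕ → ℕ} {a b : P → ℕ} {e : P ≃ Fin n}

theorem lt_iff (m : Matches n y a b e) (h : IntervalRep (P := P) (· < ·) k a b) (u v : P) :
    u < v ↔ reach n y (e u) < y (e v) := by
  rw [← (m u).2, ← (m v).1]
  exact h.lt_iff u v

/-- By `layered_iff`, the block condition on `y` reads `reach n y i < y j`, which is the order
relation of P. -/
theorem isOrdinalSum_iff_layered (m : Matches n y a b e)
    (h : IntervalRep (P := P) (· < ·) k a b) (c : ℕ) : IsOrdinalSum P c ↔ Layered c n y := by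
  unfold Layered
  simp only [Fishburn.layered_iff]
  rw [isOrdinalSum_iff]
  constructor
  · rintro ⟨f, hf, hlt⟩
    have hg : ∀ j (hj : j < n),
        (if hj : j < n then (f (e.symm ⟨j, hj⟩) : ℕ) else 0) = f (e.symm ⟨j, hj⟩) :=
      fun j hj => dif_pos hj
    refine ⟨fun j => if hj : j < n then f (e.symm ⟨j, hj⟩) else 0, fun j hj => ?_,
      fun d hd => ?_, fun i hi j hj hij => ?_⟩
    · dsimp only
      rw [hg j hj]
      exact (f _).2
    · obtain ⟨v, hv⟩ := hf ⟨d, hd⟩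
      refine ⟨e v, (e v).2, ?_⟩
      dsimp only
      rw [hg _ (e v).2]
      simp [hv]
    · dsimp only at hij
      rw [hg i hi, hg j hj] at hij
      have := (m.lt_iff h _ _).1 (hlt _ _ (Fin.lt_def.2 hij))
      simpa using this
  · rintro ⟨g, h1, h2, h3⟩
    refine ⟨fun v => ⟨g (e v), h1 _ (e v).2⟩, fun d => ?_, fun v w hvw => ?_⟩
    · obtain ⟨j, hj, hd⟩ := h2 d d.2
      exact ⟨e.symm ⟨j, hj⟩, by simp [hd]⟩
    · rw [m.lt_iff h]
      exact h3 _ (e v).2 _ (e w).2 hvw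

end Matches

theorem sum_equiv_fin {P : Type u} [Fintype P] {n : ℕ} (e : P ≃ Fin n) {M : Type*}
    [AddCommMonoid M] (f : ℕ → M) : ∑ v : P, f (e v) = ∑ j ∈ Finset.range n, f j :=
  (Equiv.sum_comp e fun j => f j).trans (Fin.sum_univ_eq_sum_range f n)

theorem ncard_equiv_fin {P : Type u} [Fintype P] {n : ℕ} (e : P ≃ Fin n) (p : ℕ → Prop)
    [DecidablePred p] : {v : P | p (e v)}.ncard = {j ∈ Finset.range n | p j}.card := by
  rw [Set.ncard_eq_toFinset_card', Finset.card_filter, ← sum_equiv_fin e, ← Finset.card_filter]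
  congr 1
  ext v
  simp

theorem chi_modified (x : List ℕ) :
    chi (modified x) = ∑ j ∈ Finset.range x.length, (X : ℕ[X]) ^ modLetter x j := by
  unfold chi
  rw [length_modified]
  rfl

theorem rmaxPos_modified (x : List ℕ) :
    rmaxPos (modified x) =
      {j ∈ Finset.range x.length | ∀ l < x.length, j < l → modLetter x l ≤ modLetter x j} := by
  unfold rmaxPos
  rw [length_modified]
  rfl

end Fishburn

/-! ### The bijections and the agreement of the statistics -/

open Fishburn in
theorem theorem5p1 (x : List ℕ) (hx : Fishburn.IsAscentSeq x) :
    -- exactly one permutation corresponds to `x`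
    (∃! π : Equiv.Perm (Fin x.length), π ∈ Fishburn.R x.length ∧ Fishburn.Lambda π = x) ∧
    -- exactly one poset, up to isomorphism, corresponds to `x`
    (∃ o : PartialOrder (Fin x.length),
      @Fishburn.TwoTwoFree (Fin x.length) o ∧ @Fishburn.Psi (Fin x.length) o = x) ∧
    (∀ (P : Type*) (P' : Type*) [PartialOrder P] [Fintype P] [PartialOrder P'] [Fintype P'],
      Fishburn.TwoTwoFree P → Fishburn.TwoTwoFree P' →
      Fishburn.Psi P = x → Fishburn.Psi P' = x → Nonempty (P ≃o P')) ∧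
    -- the statistics agree
    (∀ (P : Type*) [PartialOrder P] [Fintype P] (π : Equiv.Perm (Fin x.length)),
      Fishburn.TwoTwoFree P → Fishburn.Psi P = x →
      π ∈ Fishburn.R x.length → Fishburn.Lambda π = x →
      (Fishburn.numMin P = Fishburn.zeros x ∧
        Fishburn.zeros x = Fishburn.lmin (Fishburn.word π)) ∧
      (Fishburn.srank P = Fishburn.last x ∧
        Fishburn.last x = Fishburn.b (Fishburn.word π)) ∧
      (Fishburn.rank P = Fishburn.asc x ∧
        Fishburn.asc x = Fishburn.asc (Fishburn.word π⁻¹)) ∧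
      (Fishburn.numMax P = Fishburn.rmax (Fishburn.modified x) ∧
        Fishburn.rmax (Fishburn.modified x) = Fishburn.rmax (Fishburn.word π)) ∧
      (Fishburn.posetComp P = Fishburn.seqComp (Fishburn.modified x) ∧
        Fishburn.seqComp (Fishburn.modified x) = Fishburn.permComp (Fishburn.word π)) ∧
      (Fishburn.lam P = Fishburn.chi (Fishburn.modified x) ∧
        Fishburn.chi (Fishburn.modified x) = Fishburn.delta (Fishburn.word π)) ∧
      (Fishburn.lamBar P = Fishburn.chiBar (Fishburn.modified x) ∧
        Fishburn.chiBar (Fishburn.modified x) = Fishburn.deltaBar (Fishburn.word π))) := by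
  have hy := hx.isModifiedAscent
  have hperm : ∀ π : Equiv.Perm (Fin x.length), π ∈ R x.length ∧ Lambda π = x ↔
      SortedBy x.length (modLetter x) (word π) := fun π =>
    hx.lambdaAux_iff _ (isPermWord_word π)
  refine ⟨?_, ⟨intervalOrder x.length (modLetter x), ?_, ?_⟩, ?_, ?_⟩
  · obtain ⟨w, hw⟩ := exists_sortedBy x.length (modLetter x)
    obtain ⟨π, rfl⟩ := hw.isPermWord.exists_word_eq
    exact ⟨π, (hperm π).2 hw, fun σ hσ => word_injective (((hperm σ).1 hσ).unique hw)⟩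
  · exact @IntervalRep.twoTwoFree _ (intervalOrder _ _) _ _ _ (intervalRep_intervalOrder hy)
  · unfold Psi
    rw [Nat.card_fin]
    exact (@IsAscentSeq.psiAux_iff _ hx _ (intervalOrder _ _) _ _ _ _ (Nat.card_fin _)
      (intervalRep_intervalOrder hy)).2 ⟨Equiv.refl _, fun v => ⟨rfl, rfl⟩⟩
  · intro P P' _ _ _ _ hP hP' hx1 hx2
    obtain ⟨k, a, c, e, h, m⟩ := hx.exists_intervalRep_matches P hP hx1
    obtain ⟨k', a', c', e', h', m'⟩ := hx.exists_intervalRep_matches P' hP' hx2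
    -- Through `e` and `e'` both orders become the relation `reach < y` on positions, so matching
    -- positions gives an isomorphism.
    refine ⟨⟨e.trans e'.symm, fun {u v} => ?_⟩⟩
    rw [le_iff_eq_or_lt, le_iff_eq_or_lt, m.lt_iff h, m'.lt_iff h']
    simp
  · intro P _ _ π hP hx1 hπ hπ'
    obtain ⟨k, a, c, e, h, m⟩ := hx.exists_intervalRep_matches P hP hx1
    have hs := (hperm π).1 ⟨hπ, hπ'⟩
    have hk : k = asc x := by rw [← m.peak_eq h, hx.peak_eq]
    have hmax : ∀ v, IsMax v ↔
        ∀ t < x.length, (e v : ℕ) < t → modLetter x t ≤ modLetter x (e v) := fun v => by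
      rw [h.isMax_iff, m.right_eq_iff h hy]
    have hlev : ∀ v : P, level v = modLetter x (e v) := fun v => by
      rw [h.level_eq, (m v).1]
    refine ⟨⟨?_, ?_⟩, ⟨?_, ?_⟩, ⟨?_, ?_⟩, ⟨?_, ?_⟩, ⟨?_, ?_⟩, ⟨?_, ?_⟩, ⟨?_, ?_⟩⟩
    · unfold numMin
      simp only [h.isMin_iff, (m _).1]
      rw [ncard_equiv_fin e fun j => modLetter x j = 0, hx.zeros_eq]
    · rw [hx.zeros_eq, hs.lmin_eq hy]
    · rw [m.srank_eq h hy, modLetter_last]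
    · rw [hs.b_eq hy, modLetter_last]
    · rw [h.rank_eq, hk]
    · rw [hs.asc_inv, hx.asc_eq]
    · unfold numMax rmax
      simp only [hmax]
      rw [ncard_equiv_fin e
        fun j => ∀ t < x.length, j < t → modLetter x t ≤ modLetter x j, rmaxPos_modified]
    · rw [hs.rmax_eq, rmax, rmaxPos_modified]
    · unfold posetComp seqComp
      congr 1
      ext c
      rw [Set.mem_ofPred_eq, Set.mem_ofPred_eq, m.isOrdinalSum_iff_layered h,
        isSeqSum_iff_layered, length_modified]
      rfl
    · unfold seqComp permComp
      congr 1
      ext c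
      rw [Set.mem_ofPred_eq, Set.mem_ofPred_eq, isSeqSum_iff_layered, isPermSum_iff_layered,
        length_modified, length_word, hs.layered_iff]
      exact (and_iff_right (isPermWord_word π)).symm
    · unfold lam
      simp only [hlev]
      rw [sum_equiv_fin e fun j => (Polynomial.X : Polynomial ℕ) ^ modLetter x j, chi_modified]
    · rw [chi_modified, hs.delta_eq hy]
    · unfold lamBar chiBar
      rw [rmaxPos_modified, Finset.sum_filter, Finset.sum_filter, ← sum_equiv_fin e]
      simp only [hlev, hmax]
      rfl
    · rw [hs.deltaBar_eq hy, chiBar, rmaxPos_modified]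
      rfl
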